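/- **Proposition (local estimate in time).** Let $\Sigma$ be a compact Riemann surface with a smooth Hermitian metric $\hat\omega = i\,\hat g_{\bar z z}\,dz\wedge d\bar z$, let $\hat g^{z\bar z} = (\hat g_{\bar z z})^{-1}$, let $\kappa\in C^\infty(\Sigma,\mathbb R)$ satisfy $\kappa\le 0$, and let $\alpha'>0$. For all $0<T_0<T<\infty$ there is a constant $C(T_0,T)>0$, depending only on $T_0$, $T$, $(\Sigma,\hat\omega)$, $\kappa$ and $\alpha'$, such that the following holds. If $f$ is a smooth real function on $\Sigma\times[0,T)$ that satisfies $$\partial_t e^f = \hat g^{z\bar z}\partial_z\partial_{\bar z}\Big(e^f+\frac{\alpha'}{2}\kappa e^{-f}\Big) - \kappa\Big(e^f+\frac{\alpha'}{2}\kappa e^{-f}\Big)$$ on $\Sigma\times[0,T)$, then $e^f$ is integrable on $\Sigma\times[0,T)$ and $$\sup_{\Sigma\times[T_0,T)} e^f \;\le\; C(T_0,T)\,\max\Big\{1,\ \int_0^T\!\!\int_\Sigma e^f\,\hat\omega\,dt\Big\}.$$ In particular $C(T_0,T)$ does not depend on the initial data $f(\cdot,0)$. -/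

import Mathlib

open scoped Manifold ContDiff Laplacian
open MeasureTheory Set

noncomputable section

/-- A smooth Hermitian metric `i g dz ∧ dz̄` on a Riemann surface. `coeff e` is its coefficient
`g = g_{z̄z}` in the holomorphic coordinate `z = e`, as a function on `e.target ⊆ ℂ` (only the values
for `e` in the atlas and on `e.target` matter); `compat` is the transformation law of a `(1,1)`-form
under a holomorphic change of coordinates. -/
structure HermitianMetric (S : Type*) [TopologicalSpace S] [ChartedSpace ℂ S] where
  coeff : OpenPartialHomeomorph S ℂ → ℂ → ℝ
  pos : ∀ e ∈ atlas ℂ S, ∀ z ∈ e.target, 0 < coeff e z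
  smooth : ∀ e ∈ atlas ℂ S, ContDiffOn ℝ ∞ (coeff e) e.target
  compat : ∀ e ∈ atlas ℂ S, ∀ e' ∈ atlas ℂ S, ∀ z ∈ (e.symm.trans e').source,
    coeff e z = coeff e' (e' (e.symm z)) * ‖deriv (fun w => e' (e.symm w)) z‖ ^ 2

namespace HermitianMetric

variable {S : Type*} [TopologicalSpace S] [ChartedSpace ℂ S]

/-- The function `g^{z z̄} ∂_z ∂_{z̄} F`, computed at `x` in the holomorphic coordinate `z = e`.
Here `∂_z ∂_{z̄} = (1/4) (∂²/∂a² + ∂²/∂b²)` for `z = a + i b`. -/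
def ddbar (g : HermitianMetric S) (e : OpenPartialHomeomorph S ℂ) (F : S → ℝ) (x : S) : ℝ :=
  (g.coeff e (e x))⁻¹ * ((1 / 4) * (Δ (fun z : ℂ => F (e.symm z))) (e x))

variable [MeasurableSpace S]

/-- The area form `i g dz ∧ dz̄ = 2 g da ∧ db` (`z = a + i b`) on the domain of the chart `e`,
as a measure on `S` concentrated on `e.source`. -/
def chartArea (g : HermitianMetric S) (e : OpenPartialHomeomorph S ℂ) : Measure S :=
  Measure.map e.symm
    ((volume.restrict e.target).withDensity fun z => ENNReal.ofReal (2 * g.coeff e z))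

/-- The area measure of the metric: the least measure that dominates the area form of each chart.
On each chart domain it is the area form of the chart, see `area_restrict_source`. -/
def area (g : HermitianMetric S) : Measure S :=
  ⨆ e ∈ atlas ℂ S, g.chartArea e

variable [BorelSpace S]

theorem chartArea_apply (g : HermitianMetric S) {e : OpenPartialHomeomorph S ℂ} {A : Set S}
    (hA : MeasurableSet A) :
    g.chartArea e A = ∫⁻ z in e.target ∩ e.symm ⁻¹' A, ENNReal.ofReal (2 * g.coeff e z) := by
  have hm : AEMeasurable e.symm (volume.restrict e.target) :=
    e.continuousOn_symm.aemeasurable e.open_target.measurableSet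
  have h2 : AEMeasurable e.symm
      ((volume.restrict e.target).withDensity fun z => ENNReal.ofReal (2 * g.coeff e z)) :=
    hm.mono_ac (withDensity_absolutelyContinuous _ _)
  have hn : NullMeasurableSet (e.symm ⁻¹' A) (volume.restrict e.target) :=
    hm.nullMeasurableSet_preimage hA
  rw [chartArea, Measure.map_apply_of_aemeasurable h2 hA,
    withDensity_apply₀ _ hn, Measure.restrict_restrict₀ hn, inter_comm]

theorem chartArea_restrict_le [IsManifold 𝓘(ℂ) ω S] (g : HermitianMetric S)
    {e e' : OpenPartialHomeomorph S ℂ} (he : e ∈ atlas ℂ S) (he' : e' ∈ atlas ℂ S) :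
    (g.chartArea e').restrict e.source ≤ g.chartArea e := by
  refine Measure.le_iff.2 fun A hA => ?_
  have hAs : MeasurableSet (A ∩ e.source) := hA.inter e.open_source.measurableSet
  rw [Measure.restrict_apply hA, chartArea_apply g hAs, chartArea_apply g hA]
  set τ : ℂ → ℂ := fun w => e' (e.symm w) with hτ
  set s : Set ℂ := (e.symm.trans e').source ∩ e.symm ⁻¹' A with hs
  have hsrc : (e.symm.trans e').source = e.target ∩ e.symm ⁻¹' e'.source := by
    simp
  have hsm : MeasurableSet s := by
    have hopen : MeasurableSet (e.symm.trans e').source :=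
      (e.symm.trans e').open_source.measurableSet
    have hc : ContinuousOn e.symm (e.symm.trans e').source :=
      e.continuousOn_symm.mono (by rw [hsrc]; exact inter_subset_left)
    have := (continuousOn_iff_continuous_domRestrict.1 hc).measurable hA
    have h3 := (MeasurableEmbedding.subtype_coe hopen).measurableSet_image.2 this
    convert h3 using 1
    ext z
    simp [hs, and_comm]
  have hholo : DifferentiableOn ℂ τ (e.symm.trans e').source := by
    have h := HasGroupoid.compatible (G := contDiffGroupoid ω 𝓘(ℂ)) he he'
    have h2 := contMDiffOn_of_mem_contDiffGroupoid h
    have h3 := (contMDiffOn_iff_contDiffOn.1 h2).differentiableOn (by simp)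
    exact h3
  have himage : e'.target ∩ e'.symm ⁻¹' (A ∩ e.source) = τ '' s := by
    ext w
    constructor
    · rintro ⟨hw, hwA, hws⟩
      refine ⟨e (e'.symm w), ⟨?_, ?_⟩, ?_⟩
      · rw [hsrc]
        refine ⟨e.map_source hws, ?_⟩
        simp only [mem_preimage, e.left_inv hws]
        exact e'.map_target hw
      · simpa only [mem_preimage, e.left_inv hws] using hwA
      · simp only [hτ, e.left_inv hws, e'.right_inv hw]
    · rintro ⟨z, ⟨hz, hzA⟩, rfl⟩
      rw [hsrc] at hz
      refine ⟨e'.map_source hz.2, ?_⟩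
      have : e'.symm (τ z) = e.symm z := e'.left_inv hz.2
      simp only [mem_preimage, this]
      exact ⟨hzA, e.map_target hz.1⟩
  have hinj : InjOn τ s := (e.symm.trans e').injOn.mono inter_subset_left
  have hder : ∀ z ∈ s, HasFDerivWithinAt τ
      ((ContinuousLinearMap.toSpanSingleton ℂ (deriv τ z)).restrictScalars ℝ) s z := by
    intro z hz
    have h1 := (hholo.differentiableAt
      ((e.symm.trans e').open_source.mem_nhds hz.1)).hasDerivAt.hasFDerivAt
    exact (h1.restrictScalars ℝ).hasFDerivWithinAt
  rw [himage, lintegral_image_eq_lintegral_abs_det_fderiv_mul volume hsm hder hinj]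
  have hdet : ∀ c : ℂ, ((ContinuousLinearMap.toSpanSingleton ℂ c).restrictScalars ℝ).det
      = ‖c‖ ^ 2 := by
    intro c
    rw [ContinuousLinearMap.det]
    simp [LinearMap.det_restrictScalars, Algebra.norm_complex_eq, Complex.normSq_eq_norm_sq]
  calc ∫⁻ z in s, ENNReal.ofReal
          |((ContinuousLinearMap.toSpanSingleton ℂ (deriv τ z)).restrictScalars ℝ).det|
          * ENNReal.ofReal (2 * g.coeff e' (τ z))
      = ∫⁻ z in s, ENNReal.ofReal (2 * g.coeff e z) := by
        refine setLIntegral_congr_fun hsm fun z hz => ?_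
        simp only [hdet]
        rw [← ENNReal.ofReal_mul (abs_nonneg _), abs_of_nonneg (by positivity),
          g.compat e he e' he' z hz.1]
        congr 1
        ring
    _ ≤ ∫⁻ z in e.target ∩ e.symm ⁻¹' A, ENNReal.ofReal (2 * g.coeff e z) := by
        refine lintegral_mono_set ?_
        rw [hs, hsrc]
        exact fun z hz => ⟨hz.1.1, hz.2⟩

theorem area_restrict_source [IsManifold 𝓘(ℂ) ω S] (g : HermitianMetric S)
    {e : OpenPartialHomeomorph S ℂ} (he : e ∈ atlas ℂ S) :
    g.area.restrict e.source = g.chartArea e := by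
  have hms := e.open_source.measurableSet
  have hle : ∀ e' ∈ atlas ℂ S, g.chartArea e' ≤ g.area := fun e' he' =>
    le_iSup₂ (f := fun e (_ : e ∈ atlas ℂ S) => g.chartArea e) e' he'
  have hself : (g.chartArea e).restrict e.source = g.chartArea e := by
    refine Measure.ext fun A hA => ?_
    rw [Measure.restrict_apply hA, chartArea_apply g (hA.inter hms), chartArea_apply g hA]
    congr 2
    ext z
    simp only [mem_inter_iff, mem_preimage]
    exact ⟨fun h => ⟨h.1, h.2.1⟩, fun h => ⟨h.1, h.2, e.map_target h.1⟩⟩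
  refine le_antisymm ?_ ?_
  · have hbound : g.area ≤ g.chartArea e + g.area.restrict e.sourceᶜ := by
      refine iSup₂_le fun e' he' => ?_
      rw [← Measure.restrict_add_restrict_compl (μ := g.chartArea e') hms]
      exact add_le_add (chartArea_restrict_le g he he')
        (Measure.restrict_mono subset_rfl (hle e' he'))
    refine (Measure.restrict_mono subset_rfl hbound).trans ?_
    rw [Measure.restrict_add, Measure.restrict_restrict hms, inter_compl_self,
      Measure.restrict_empty, add_zero, hself]
  · rw [← hself]
    exact Measure.restrict_mono subset_rfl (hle e he)

end HermitianMetric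

/-- `f` is a smooth solution on `S × [0,T)` of
`∂_t e^f = g^{z z̄} ∂_z ∂_{z̄} (e^f + (α/2) κ e^{-f}) - κ (e^f + (α/2) κ e^{-f})`,
the equation being read in every holomorphic chart of the atlas (one-sided derivative at `t = 0`). -/
structure IsFlowSolution {S : Type*} [TopologicalSpace S] [ChartedSpace ℂ S]
    (g : HermitianMetric S) (κ : S → ℝ) (α T : ℝ) (f : ℝ → S → ℝ) : Prop where
  smooth : ContMDiffOn (𝓘(ℝ, ℝ).prod 𝓘(ℝ, ℂ)) 𝓘(ℝ, ℝ) ∞ (fun p : ℝ × S => f p.1 p.2)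
    (Ico 0 T ×ˢ univ)
  equation : ∀ t ∈ Ico 0 T, ∀ e ∈ atlas ℂ S, ∀ x ∈ e.source,
    HasDerivWithinAt (fun s => Real.exp (f s x))
      (g.ddbar e (fun y => Real.exp (f t y) + α / 2 * κ y * Real.exp (-f t y)) x
        - κ x * (Real.exp (f t x) + α / 2 * κ x * Real.exp (-f t x)))
      (Ico 0 T) t

end

/-!
The function `φ = e^f + (α/2) κ e^{-f}` satisfies, in a holomorphic coordinate, an equation in
nondivergence form without first order terms, `∂ₜφ = b (Δφ / (4g) - κ φ)` with
`b = 1 - (α/2) κ e^{-2f}`. As `κ ≤ 0`, we have `φ ≤ e^f`, so `1 ≤ b ≤ 1 + (α/2) max |κ|` where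
`φ ≥ 1`: there `φ` is a subsolution of a uniformly parabolic equation with a coefficient about which
nothing but bounds is known (`IsFlowSolution.potential_subsolution`). Where `φ < 1` the equation may
degenerate, but there is nothing to prove.

Such subsolutions satisfy a local maximum principle with the `L¹` norm (`exists_local_bound`), which
follows in one step from the Alexandrov–Bakelman–Pucci estimate of Krylov and Tso
(`parabolic_abp`). Let `w = η φ` with a weight `η = t³ (1 - |z - c|² / R²)⁶` that vanishes on the
parabolic boundary, and let `M = max w`. Every affine function `h + ⟪ξ, z - c⟫` with
`M/4 ≤ h ≤ M/2` and `|ξ| ≤ M / (8R)` is touched from below by `w` at a first time; at this contact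
point `∂ₜw ≥ 0`, `D²w ≤ 0`, and the affine function is given by the Legendre map `legendreMap`,
whose Jacobian is `∂ₜw · det D²w`. The area formula bounds the volume of this set of affine functions,
a multiple of `M³ / R²`, by the integral of `∂ₜw · det D²w` over the contact points. At these points
`w ≥ M/8`, hence `φ ≥ 1` unless `M` is bounded by a constant, and `|∇w| ≤ M / (8R)`, so that all
terms in which derivatives fall on `η` are at most a multiple of `w η^{-1/3}`; therefore the
Jacobian is at most a multiple of `w³ η⁻¹ = w² φ ≤ M² φ`, and `M³ ≤ C M² ∫ φ`.

The maximum principle on the compact surface shows that `e^f` is bounded on `[0, T)` for each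
solution (`IsFlowSolution.exists_bound`), which gives the integrability. Lebesgue measure in a
coordinate disc is at most a multiple of the area measure
(`IsFlowSolution.setLIntegral_chart_le`), and finitely many half discs cover the surface.
-/

noncomputable section

open Filter Topology

/-! ### Second derivatives along lines -/

/-- Necessary second order condition at a local maximum, for a function that is differentiable near
the point and twice differentiable at it. -/
theorem IsLocalMax.second_deriv_nonpos {f f' : ℝ → ℝ} {x a : ℝ} (hmax : IsLocalMax f x)
    (hf : ∀ᶠ s in 𝓝 x, HasDerivAt f (f' s) s) (hf' : HasDerivAt f' a x) : a ≤ 0 := by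
  by_contra! ha
  have hderiv : deriv f =ᶠ[𝓝 x] f' := hf.mono fun s hs => hs.deriv
  have h2 : deriv (deriv f) x = a := by rw [hderiv.deriv_eq, hf'.deriv]
  -- A positive second derivative makes `x` a local minimum too, so `f` is locally constant.
  have hmin : IsLocalMin f x := isLocalMin_of_deriv_deriv_pos (h2 ▸ ha) hmax.deriv_eq_zero
    hf.self_of_nhds.continuousAt
  have hconst : f =ᶠ[𝓝 x] fun _ => f x := by
    filter_upwards [hmax, hmin] with s h1 h2 using le_antisymm h1 h2
  have h3 : deriv (deriv f) x = 0 := by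
    rw [hconst.deriv.deriv_eq]
    simp
  exact ha.ne' (h2.symm.trans h3)

theorem HasDerivAt.nonneg_of_le_left {f : ℝ → ℝ} {x a : ℝ} (hf : HasDerivAt f a x)
    (hle : ∀ᶠ s in 𝓝[<] x, f s ≤ f x) : 0 ≤ a := by
  have h := hf.hasDerivWithinAt (s := Iio x)
  rw [hasDerivWithinAt_iff_tendsto_slope' (by simp)] at h
  refine ge_of_tendsto h ?_
  filter_upwards [hle, self_mem_nhdsWithin] with s hs hsx
  rw [slope_def_field]
  exact div_nonneg_of_nonpos (sub_nonpos.2 hs) (sub_nonpos.2 (le_of_lt hsx))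

theorem ContDiffAt.hasDerivAt_line {E : Type*} [NormedAddCommGroup E] [NormedSpace ℝ E]
    {w : E → ℝ} {p : E} (hw : ContDiffAt ℝ 2 w p) (v : E) :
    (∀ᶠ s in 𝓝 (0 : ℝ), HasDerivAt (fun s : ℝ => w (p + s • v)) (fderiv ℝ w (p + s • v) v) s) ∧
      HasDerivAt (fun s : ℝ => fderiv ℝ w (p + s • v) v) (fderiv ℝ (fderiv ℝ w) p v v) 0 := by
  have hline : ∀ s : ℝ, HasDerivAt (fun s : ℝ => p + s • v) v s := fun s => by
    simpa using ((hasDerivAt_id s).smul_const v).const_add p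
  have hp : p + (0 : ℝ) • v = p := by simp
  constructor
  · have h1 : ∀ᶠ q in 𝓝 p, ContDiffAt ℝ 2 w q := hw.eventually (by simp)
    have hc : Tendsto (fun s : ℝ => p + s • v) (𝓝 0) (𝓝 p) := by
      have := (hline 0).continuousAt.tendsto
      rwa [hp] at this
    filter_upwards [hc.eventually h1] with s hs
    exact (hs.differentiableAt (by simp)).hasFDerivAt.comp_hasDerivAt s (hline s)
  · have h1 : DifferentiableAt ℝ (fderiv ℝ w) p :=
      (hw.fderiv_right (m := 1) (by norm_num)).differentiableAt (by simp)
    have h2 : HasFDerivAt (fderiv ℝ w) (fderiv ℝ (fderiv ℝ w) p) (p + (0 : ℝ) • v) := by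
      rw [hp]; exact h1.hasFDerivAt
    have h3 : HasDerivAt (fun s : ℝ => fderiv ℝ w (p + s • v)) (fderiv ℝ (fderiv ℝ w) p v) 0 :=
      h2.comp_hasDerivAt 0 (hline 0)
    exact (ContinuousLinearMap.apply ℝ ℝ v).hasFDerivAt.comp_hasDerivAt 0 h3

/-! ### The parabolic Alexandrov–Bakelman–Pucci estimate -/

theorem ContinuousLinearMap.det_real_prod_complex (L : ℝ × ℂ →L[ℝ] ℝ × ℂ) :
    L.det = Matrix.det
      !![(L (1, 0)).1, (L (0, 1)).1, (L (0, Complex.I)).1;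
        (L (1, 0)).2.re, (L (0, 1)).2.re, (L (0, Complex.I)).2.re;
        (L (1, 0)).2.im, (L (0, 1)).2.im, (L (0, Complex.I)).2.im] := by
  let e : (ℝ × ℂ) ≃ₗ[ℝ] (Fin 3 → ℝ) :=
    { toFun := fun p => ![p.1, p.2.re, p.2.im]
      invFun := fun x => (x 0, ⟨x 1, x 2⟩)
      map_add' := fun p q => by ext i; fin_cases i <;> simp
      map_smul' := fun r p => by ext i; fin_cases i <;> simp
      left_inv := fun p => by simp
      right_inv := fun x => by ext i; fin_cases i <;> simp }
  let B := Module.Basis.ofEquivFun e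
  have hB : ∀ i, B i = ![((1 : ℝ), (0 : ℂ)), (0, 1), (0, Complex.I)] i := fun i => by
    rw [Module.Basis.coe_ofEquivFun]
    change ((Function.update (0 : Fin 3 → ℝ) i 1) 0,
      (⟨(Function.update (0 : Fin 3 → ℝ) i 1) 1, (Function.update (0 : Fin 3 → ℝ) i 1) 2⟩ : ℂ)) = _
    fin_cases i <;> simp [Complex.ext_iff]
  rw [ContinuousLinearMap.det, ← LinearMap.det_toMatrix B]
  congr 1
  ext i j
  rw [LinearMap.toMatrix_apply, hB, Module.Basis.ofEquivFun_repr_apply]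
  fin_cases i <;> fin_cases j <;> rfl

/-- The parabolic Legendre map `(t, z) ↦ (w - (z - c) · ∇w, ∇w)` of a function of `t ∈ ℝ` and
`z ∈ ℂ`; `∇` is the gradient in `z`, and the first component is the value at `c` of the tangent
plane of `w (t, ·)` at `z`. -/
def legendreMap (c : ℂ) (w : ℝ × ℂ → ℝ) (p : ℝ × ℂ) : ℝ × ℂ :=
  (w p - fderiv ℝ w p (0, p.2 - c),
    (fderiv ℝ w p (0, 1) : ℂ) + (fderiv ℝ w p (0, Complex.I) : ℂ) * Complex.I)

theorem clm_apply_complex (D : ℝ × ℂ →L[ℝ] ℝ) (z : ℂ) :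
    D (0, z) = z.re * D (0, 1) + z.im * D (0, Complex.I) := by
  have : ((0 : ℝ), z) = z.re • ((0 : ℝ), (1 : ℂ)) + z.im • ((0 : ℝ), Complex.I) := by
    ext <;> simp
  rw [this, map_add, map_smul, map_smul, smul_eq_mul, smul_eq_mul]

/-- The Jacobian of the Legendre map is `∂ₜw · det D²w`. -/
theorem differentiableAt_legendreMap_and_det {c : ℂ} {w : ℝ × ℂ → ℝ} {p : ℝ × ℂ}
    (hw : ContDiffAt ℝ 2 w p) :
    DifferentiableAt ℝ (legendreMap c w) p ∧
    (fderiv ℝ (legendreMap c w) p).det = fderiv ℝ w p (1, 0) *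
      (fderiv ℝ (fderiv ℝ w) p (0, 1) (0, 1) *
          fderiv ℝ (fderiv ℝ w) p (0, Complex.I) (0, Complex.I)
        - fderiv ℝ (fderiv ℝ w) p (0, 1) (0, Complex.I) ^ 2) := by
  have hD : HasFDerivAt (fderiv ℝ w) (fderiv ℝ (fderiv ℝ w) p) p :=
    ((hw.fderiv_right (m := 1) (by norm_num)).differentiableAt (by simp)).hasFDerivAt
  have hw1 : HasFDerivAt w (fderiv ℝ w p) p := (hw.differentiableAt (by simp)).hasFDerivAt
  have hsymm : fderiv ℝ (fderiv ℝ w) p (0, Complex.I) (0, 1)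
      = fderiv ℝ (fderiv ℝ w) p (0, 1) (0, Complex.I) :=
    (hw.isSymmSndFDerivAt (by simp)).eq _ _
  have hlin : HasFDerivAt (fun q : ℝ × ℂ => ((0 : ℝ), q.2 - c))
      ((0 : ℝ × ℂ →L[ℝ] ℝ).prod (ContinuousLinearMap.snd ℝ ℝ ℂ)) p :=
    (hasFDerivAt_const (0 : ℝ) p).prodMk (hasFDerivAt_snd.sub_const c)
  have hconst : ∀ v : ℝ × ℂ, HasFDerivAt (fun q => fderiv ℝ w q v)
      ((ContinuousLinearMap.apply ℝ ℝ v).comp (fderiv ℝ (fderiv ℝ w) p)) p := fun v => by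
    exact (ContinuousLinearMap.apply ℝ ℝ v).hasFDerivAt.comp p hD
  have h2 : ∀ v : ℝ × ℂ, HasFDerivAt (fun q => ((fderiv ℝ w q v : ℝ) : ℂ))
      (Complex.ofRealCLM.comp
        ((ContinuousLinearMap.apply ℝ ℝ v).comp (fderiv ℝ (fderiv ℝ w) p))) p := fun v =>
    Complex.ofRealCLM.hasFDerivAt.comp p (hconst v)
  have hΦ := (hw1.sub (hD.clm_apply hlin)).prodMk
    ((h2 (0, 1)).add ((h2 (0, Complex.I)).mul_const Complex.I))
  have hΦ' : HasFDerivAt (legendreMap c w) _ p := hΦ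
  refine ⟨hΦ'.differentiableAt, ?_⟩
  rw [hΦ'.fderiv, ContinuousLinearMap.det_real_prod_complex, Matrix.det_fin_three]
  simp only [Matrix.of_apply, Matrix.cons_val', Matrix.cons_val_zero, Matrix.cons_val_one,
    Matrix.cons_val]
  simp [clm_apply_complex _ (p.2 - c), hsymm]
  simp only [Prod.mk_zero_zero, map_zero]
  ring

/-- The determinant of a negative semidefinite symmetric `2 × 2` matrix lies between `0` and a
quarter of the squared trace. -/
theorem det_bounds_of_nonpos {a b d : ℝ}
    (h : ∀ x y : ℝ, x ^ 2 * a + 2 * x * y * b + y ^ 2 * d ≤ 0) :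
    0 ≤ a * d - b ^ 2 ∧ a * d - b ^ 2 ≤ (a + d) ^ 2 / 4 := by
  have ha : a ≤ 0 := by simpa using h 1 0
  constructor
  · rcases ha.lt_or_eq with ha | ha
    · have h1 := h b (-a)
      by_contra! hneg
      nlinarith
    · have hb : b = 0 := by
        by_contra hb
        have h1 := h ((1 - d) / (2 * b)) 1
        have : 2 * ((1 - d) / (2 * b)) * 1 * b = 1 - d := by field_simp
        rw [ha] at h1
        linarith
      simp [ha, hb]
  · nlinarith [sq_nonneg (a - d), sq_nonneg b]

/-- First contact: a function on a parabolic cylinder that is nonpositive on the parabolic boundary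
and reaches the value `M` is touched from above by every affine function `h + ⟪ξ, z - c⟫` with
`h ∈ [M/4, M/2]` and `|ξ| ≤ M / (8R)`, at the first time at which it reaches that function. -/
theorem exists_contact {c : ℂ} {w : ℝ × ℂ → ℝ} {R t₁ M : ℝ} (hR : 0 < R) (hM : 0 < M)
    (hcont : ContinuousOn w (Icc 0 t₁ ×ˢ Metric.closedBall c R))
    (h0 : ∀ z ∈ Metric.closedBall c R, w (0, z) ≤ 0)
    (hlat : ∀ t ∈ Icc 0 t₁, ∀ z ∈ Metric.sphere c R, w (t, z) ≤ 0)
    (hmax : ∃ p ∈ Icc 0 t₁ ×ˢ Metric.closedBall c R, M ≤ w p)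
    {h : ℝ} (hh : h ∈ Icc (M / 4) (M / 2)) {ξ : ℂ} (hξ : ‖ξ‖ ≤ M / (8 * R)) :
    ∃ t ∈ Ioc 0 t₁, ∃ z ∈ Metric.ball c R,
      w (t, z) = h + inner ℝ ξ (z - c) ∧ M / 8 ≤ w (t, z) ∧
      (∀ s ∈ Ico 0 t, w (s, z) < w (t, z)) ∧
      ∀ y ∈ Metric.closedBall c R, w (t, y) ≤ h + inner ℝ ξ (y - c) := by
  have hin : ∀ z ∈ Metric.closedBall c R, |inner ℝ ξ (z - c)| ≤ M / 8 := fun z hz => by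
    have hz' : ‖z - c‖ ≤ R := by simpa [dist_eq_norm] using hz
    calc |inner ℝ ξ (z - c)| ≤ ‖ξ‖ * ‖z - c‖ := abs_real_inner_le_norm _ _
      _ ≤ M / (8 * R) * R := by gcongr
      _ = M / 8 := by field_simp
  set G : ℝ × ℂ → ℝ := fun p => w p - (h + inner ℝ ξ (p.2 - c)) with hG
  have hGc : ContinuousOn G (Icc 0 t₁ ×ˢ Metric.closedBall c R) := by
    refine hcont.sub (Continuous.continuousOn ?_)
    fun_prop
  have hKc : IsCompact (Icc (0 : ℝ) t₁ ×ˢ Metric.closedBall c R) :=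
    isCompact_Icc.prod (isCompact_closedBall c R)
  set K : Set (ℝ × ℂ) := (Icc 0 t₁ ×ˢ Metric.closedBall c R) ∩ G ⁻¹' Ici 0 with hK
  have hKclosed : IsClosed K := hGc.preimage_isClosed_of_isClosed hKc.isClosed isClosed_Ici
  have hKcompact : IsCompact K := hKc.of_isClosed_subset hKclosed inter_subset_left
  have hKne : K.Nonempty := by
    obtain ⟨p, hp, hMp⟩ := hmax
    refine ⟨p, hp, ?_⟩
    have := (abs_le.1 (hin p.2 hp.2)).2
    simp only [hG, mem_preimage, mem_Ici]
    linarith [hh.2]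
  obtain ⟨⟨t, z⟩, hpK, hmin⟩ := hKcompact.exists_isMinOn hKne continuous_fst.continuousOn
  have htI : t ∈ Icc 0 t₁ := hpK.1.1
  have hzB : z ∈ Metric.closedBall c R := hpK.1.2
  have hGp : 0 ≤ G (t, z) := hpK.2
  have hlow : ∀ y ∈ Metric.closedBall c R, M / 8 ≤ h + inner ℝ ξ (y - c) := fun y hy => by
    have := (abs_le.1 (hin y hy)).1
    linarith [hh.1]
  have hwz : M / 8 ≤ w (t, z) := by
    have := hlow z hzB
    simp only [hG] at hGp
    linarith
  have ht0 : 0 < t := by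
    refine lt_of_le_of_ne htI.1 fun h0t => ?_
    have := h0 z hzB
    rw [h0t] at this
    linarith
  have hzb : z ∈ Metric.ball c R := by
    refine Metric.mem_ball.2 (lt_of_le_of_ne (Metric.mem_closedBall.1 hzB) fun hzs => ?_)
    have := hlat t htI z hzs
    linarith
  have hbefore : ∀ s ∈ Ico 0 t, ∀ y ∈ Metric.closedBall c R, G (s, y) < 0 := by
    intro s hs y hy
    by_contra! hge
    have : t ≤ s := hmin (show (s, y) ∈ K from ⟨⟨⟨hs.1, hs.2.le.trans htI.2⟩, hy⟩, hge⟩)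
    exact absurd hs.2 (not_lt.2 this)
  have hle : ∀ y ∈ Metric.closedBall c R, G (t, y) ≤ 0 := by
    intro y hy
    have hc1 : ContinuousOn (fun s => G (s, y)) (Icc 0 t) :=
      hGc.comp (by fun_prop) fun s hs => ⟨⟨hs.1, hs.2.trans htI.2⟩, hy⟩
    have h1 : Tendsto (fun s => G (s, y)) (𝓝[Ico 0 t] t) (𝓝 (G (t, y))) :=
      (hc1 t ⟨ht0.le, le_rfl⟩).mono Ico_subset_Icc_self
    have : (𝓝[Ico 0 t] t).NeBot := by
      rw [← mem_closure_iff_nhdsWithin_neBot, closure_Ico ht0.ne]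
      exact ⟨ht0.le, le_rfl⟩
    exact le_of_tendsto h1 (eventually_nhdsWithin_of_forall fun s hs => (hbefore s hs y hy).le)
  have heq : w (t, z) = h + inner ℝ ξ (z - c) := by
    have := hle z hzB
    simp only [hG] at this hGp
    linarith
  refine ⟨t, ⟨ht0, htI.2⟩, z, hzb, heq, hwz, fun s hs => ?_, fun y hy => ?_⟩
  · have := hbefore s hs z hzB
    simp only [hG] at this
    linarith
  · have := hle y hy
    simp only [hG] at this
    linarith

/-- **Parabolic ABP estimate** in two space variables. Let `w` be nonpositive on the parabolic
boundary of a cylinder and reach the value `M > 0`. If `∂ₜw · (Δw)² / 4 ≤ G` wherever `w` is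
increasing in time, concave to second order in space, at least `M / 8` and of slope at most
`M / (8R)`, then `∫ G` is at least the volume of the set of affine functions of
`exists_contact`. -/
theorem parabolic_abp {c : ℂ} {w G : ℝ × ℂ → ℝ} {R t₁ M : ℝ} (hR : 0 < R) (hM : 0 < M)
    (hcont : ContinuousOn w (Icc 0 t₁ ×ˢ Metric.closedBall c R))
    (hdiff : ∀ p ∈ Ioc 0 t₁ ×ˢ Metric.ball c R, ContDiffAt ℝ 2 w p)
    (h0 : ∀ z ∈ Metric.closedBall c R, w (0, z) ≤ 0)
    (hlat : ∀ t ∈ Icc 0 t₁, ∀ z ∈ Metric.sphere c R, w (t, z) ≤ 0)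
    (hmax : ∃ p ∈ Icc 0 t₁ ×ˢ Metric.closedBall c R, M ≤ w p)
    (hGc : ContinuousOn G (Ioc 0 t₁ ×ˢ Metric.ball c R))
    (hG : ∀ p ∈ Ioc 0 t₁ ×ˢ Metric.ball c R, M / 8 ≤ w p → 0 ≤ fderiv ℝ w p (1, 0) →
      (∀ v : ℂ, ‖v‖ = 1 → |fderiv ℝ w p (0, v)| ≤ M / (8 * R)) →
      (∀ v : ℂ, fderiv ℝ (fderiv ℝ w) p (0, v) (0, v) ≤ 0) →
      fderiv ℝ w p (1, 0) * ((fderiv ℝ (fderiv ℝ w) p (0, 1) (0, 1)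
        + fderiv ℝ (fderiv ℝ w) p (0, Complex.I) (0, Complex.I)) ^ 2 / 4) ≤ G p) :
    ENNReal.ofReal (M / 4 * (Real.pi * (M / (8 * R)) ^ 2)) ≤
      ∫⁻ p in Ioc 0 t₁ ×ˢ Metric.ball c R, ENNReal.ofReal (G p) := by
  classical
  set Q : Set (ℝ × ℂ) := Ioc 0 t₁ ×ˢ Metric.ball c R with hQ
  have hQm : MeasurableSet Q := measurableSet_Ioc.prod Metric.isOpen_ball.measurableSet
  set Φ := legendreMap c w with hΦ
  set s : Set (ℝ × ℂ) := Q ∩ {p | |(fderiv ℝ Φ p).det| ≤ Q.piecewise G 0 p} with hs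
  have hsm : MeasurableSet s := by
    refine hQm.inter (measurableSet_le ?_ ?_)
    · exact (ContinuousLinearMap.continuous_det.measurable.comp (measurable_fderiv ℝ Φ)).abs
    · exact hGc.measurable_piecewise continuousOn_const hQm
  have hcover : Icc (M / 4) (M / 2) ×ˢ Metric.closedBall (0 : ℂ) (M / (8 * R)) ⊆ Φ '' s := by
    rintro ⟨h, ξ⟩ ⟨hh, hξ⟩
    have hξ : ‖ξ‖ ≤ M / (8 * R) := by simpa using hξ
    obtain ⟨t, ht, z, hz, heq, hlow, htime, hspace⟩ :=
      exists_contact hR hM hcont h0 hlat hmax hh hξ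
    set p : ℝ × ℂ := (t, z) with hp
    have hpQ : p ∈ Q := ⟨ht, hz⟩
    have hw := hdiff p hpQ
    -- In every space direction, `w` minus the affine function has a local maximum.
    have hline : ∀ v : ℂ, IsLocalMax
        (fun r : ℝ => w (p + r • ((0 : ℝ), v)) - r * inner ℝ ξ v) 0 := fun v => by
      have hball : ∀ᶠ r : ℝ in 𝓝 0, z + r • v ∈ Metric.ball c R := by
        have : ContinuousAt (fun r : ℝ => z + r • v) 0 := by fun_prop
        exact this.eventually_mem (Metric.isOpen_ball.mem_nhds (by simpa using hz))
      filter_upwards [hball] with r hr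
      have h1 := hspace _ (Metric.ball_subset_closedBall hr)
      have h2 : p + r • ((0 : ℝ), v) = (t, z + r • v) := by simp [hp]
      have h3 : z + r • v - c = (z - c) + r • v := by ring
      rw [h3, inner_add_right, inner_smul_right] at h1
      simp only [h2, zero_smul, add_zero, zero_mul, sub_zero]
      rw [hp, heq]
      linarith
    have hfd : ∀ v : ℂ, ∀ᶠ r in 𝓝 (0 : ℝ), HasDerivAt
        (fun r : ℝ => w (p + r • ((0 : ℝ), v)) - r * inner ℝ ξ v)
        (fderiv ℝ w (p + r • ((0 : ℝ), v)) (0, v) - inner ℝ ξ v) r := fun v => by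
      filter_upwards [(hw.hasDerivAt_line ((0 : ℝ), v)).1] with r hr
      exact (hr.sub ((hasDerivAt_id r).mul_const (inner ℝ ξ v))).congr_deriv (by rw [one_mul])
    have hgrad : ∀ v : ℂ, fderiv ℝ w p (0, v) = inner ℝ ξ v := fun v => by
      have := (hline v).hasDerivAt_eq_zero (hfd v).self_of_nhds
      simp only [zero_smul, add_zero] at this
      linarith
    have hhess : ∀ v : ℂ, fderiv ℝ (fderiv ℝ w) p (0, v) (0, v) ≤ 0 := fun v =>
      (hline v).second_deriv_nonpos (hfd v)
        ((hw.hasDerivAt_line ((0 : ℝ), v)).2.sub_const (inner ℝ ξ v))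
    have htder : 0 ≤ fderiv ℝ w p (1, 0) := by
      have h1 : HasDerivAt (fun r : ℝ => w (p + r • ((1 : ℝ), (0 : ℂ))))
          (fderiv ℝ w p (1, 0)) 0 := by
        simpa using (hw.hasDerivAt_line ((1 : ℝ), (0 : ℂ))).1.self_of_nhds
      refine h1.nonneg_of_le_left ?_
      have h3 : ∀ᶠ r in 𝓝[<] (0 : ℝ), -t < r :=
        eventually_nhdsWithin_of_eventually_nhds (lt_mem_nhds (by linarith [ht.1]))
      filter_upwards [h3, self_mem_nhdsWithin] with r hr hr0
      have hr0 : r < 0 := hr0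
      have h4 := htime (t + r) ⟨by linarith, by linarith⟩
      simp only [hp, Prod.smul_mk, smul_eq_mul, mul_one, Prod.mk_add_mk, smul_zero, add_zero]
      exact h4.le
    refine ⟨p, ⟨hpQ, ?_⟩, ?_⟩
    · obtain ⟨hd0, hd1⟩ := det_bounds_of_nonpos (a := fderiv ℝ (fderiv ℝ w) p (0, 1) (0, 1))
        (b := fderiv ℝ (fderiv ℝ w) p (0, 1) (0, Complex.I))
        (d := fderiv ℝ (fderiv ℝ w) p (0, Complex.I) (0, Complex.I)) fun x y => by
          have hsymm : fderiv ℝ (fderiv ℝ w) p (0, Complex.I) (0, 1)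
              = fderiv ℝ (fderiv ℝ w) p (0, 1) (0, Complex.I) :=
            (hw.isSymmSndFDerivAt (by simp)).eq _ _
          have h1 := hhess ⟨x, y⟩
          have h2 : ((0 : ℝ), (⟨x, y⟩ : ℂ)) =
              x • ((0 : ℝ), (1 : ℂ)) + y • ((0 : ℝ), Complex.I) := by
            refine Prod.ext (by simp) (Complex.ext ?_ ?_) <;> simp
          rw [h2] at h1
          simp only [map_add, map_smul, add_apply,
            smul_apply, smul_eq_mul, hsymm] at h1
          linarith
      simp only [mem_ofPred_eq, piecewise_eq_of_mem _ _ _ hpQ]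
      rw [(differentiableAt_legendreMap_and_det hw).2, abs_of_nonneg (mul_nonneg htder hd0)]
      refine (mul_le_mul_of_nonneg_left hd1 htder).trans
        (hG p hpQ hlow htder (fun v hv => ?_) hhess)
      rw [hgrad]
      calc |inner ℝ ξ v| ≤ ‖ξ‖ * ‖v‖ := abs_real_inner_le_norm _ _
        _ ≤ M / (8 * R) := by rw [hv, mul_one]; exact hξ
    · rw [hΦ, legendreMap, hgrad, hgrad, hgrad]
      refine Prod.ext ?_ ?_
      · change w p - inner ℝ ξ (z - c) = h
        rw [hp, heq]; ring
      · refine Complex.ext ?_ ?_ <;> simp [Complex.inner]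
  have hHaar : (volume : Measure (ℝ × ℂ)).IsAddHaarMeasure :=
    Measure.prod.instIsAddHaarMeasure volume volume
  calc ENNReal.ofReal (M / 4 * (Real.pi * (M / (8 * R)) ^ 2))
      = volume (Icc (M / 4) (M / 2) ×ˢ Metric.closedBall (0 : ℂ) (M / (8 * R))) := by
        rw [Measure.volume_eq_prod, Measure.prod_prod, Real.volume_Icc, Complex.volume_closedBall,
          ENNReal.ofReal_mul (by positivity), ENNReal.ofReal_mul (by positivity),
          ← ENNReal.ofReal_pow (by positivity), mul_comm (ENNReal.ofReal Real.pi)]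
        congr 2
        · ring
        · rw [← ENNReal.ofReal_coe_nnreal]; rfl
    _ ≤ volume (Φ '' s) := measure_mono hcover
    _ ≤ ∫⁻ p in s, ENNReal.ofReal |(fderiv ℝ Φ p).det| :=
        addHaar_image_le_lintegral_abs_det_fderiv volume hsm fun p hp =>
          (differentiableAt_legendreMap_and_det (hdiff p hp.1)).1.hasFDerivAt.hasFDerivWithinAt
    _ ≤ ∫⁻ p in s, ENNReal.ofReal (G p) := by
        refine setLIntegral_mono' hsm fun p hp => ENNReal.ofReal_le_ofReal ?_
        have := hp.2
        rwa [mem_ofPred_eq, piecewise_eq_of_mem _ _ _ hp.1] at this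
    _ ≤ ∫⁻ p in Q, ENNReal.ofReal (G p) := lintegral_mono_set inter_subset_left

/-! ### A local maximum principle with the `L¹` norm -/

/-- The weight `t³ (1 - |z - c|² / R²)⁶`, which vanishes on the parabolic boundary of the cylinder
`[0, t₁] × ball c R`. The exponents are such that its derivatives in the equation are bounded by
a multiple of its power `2/3`, which is what turns the `L³` norm of the ABP estimate
into an `L¹` norm. -/
def cylinderWeight (c : ℂ) (R : ℝ) (p : ℝ × ℂ) : ℝ :=
  p.1 ^ 3 * (1 - ‖p.2 - c‖ ^ 2 / R ^ 2) ^ 6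

theorem contDiff_cylinderWeight (c : ℂ) (R : ℝ) : ContDiff ℝ 2 (cylinderWeight c R) := by
  have h : ContDiff ℝ 2 fun p : ℝ × ℂ => ‖p.2 - c‖ ^ 2 :=
    (contDiff_snd.sub contDiff_const).norm_sq ℝ
  exact (contDiff_fst.pow 3).mul ((contDiff_const.sub (h.div_const _)).pow 6)

theorem fderiv_cylinderWeight_mul_time {c : ℂ} {R : ℝ} {φ : ℝ × ℂ → ℝ} {p : ℝ × ℂ}
    (hφ : ContDiffAt ℝ 2 φ p) :
    fderiv ℝ (fun q => cylinderWeight c R q * φ q) p (1, 0) =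
      3 * p.1 ^ 2 * (1 - ‖p.2 - c‖ ^ 2 / R ^ 2) ^ 6 * φ p
        + cylinderWeight c R p * fderiv ℝ φ p (1, 0) := by
  have hw : ContDiffAt ℝ 2 (fun q => cylinderWeight c R q * φ q) p :=
    (contDiff_cylinderWeight c R).contDiffAt.mul hφ
  have h1 := (hw.hasDerivAt_line ((1 : ℝ), (0 : ℂ))).1.self_of_nhds
  have h2 := (hφ.hasDerivAt_line ((1 : ℝ), (0 : ℂ))).1.self_of_nhds
  have h3 : HasDerivAt (fun s : ℝ => (p.1 + s) ^ 3) (3 * p.1 ^ 2) 0 := by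
    have := ((hasDerivAt_id (0 : ℝ)).const_add p.1).pow 3
    exact this.congr_deriv (by simp)
  have h4 := (h3.mul_const ((1 - ‖p.2 - c‖ ^ 2 / R ^ 2) ^ 6)).mul h2
  have heq : (fun s : ℝ => cylinderWeight c R (p + s • ((1 : ℝ), (0 : ℂ)))
      * φ (p + s • ((1 : ℝ), (0 : ℂ)))) =
      ((fun s : ℝ => (p.1 + s) ^ 3 * (1 - ‖p.2 - c‖ ^ 2 / R ^ 2) ^ 6) *
        fun s => φ (p + s • ((1 : ℝ), (0 : ℂ)))) := by
    ext s
    simp [cylinderWeight]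
  have h5 := (heq ▸ h1).unique h4
  simp only [zero_smul, add_zero] at h5
  rw [h5, cylinderWeight]

/-- First and second space derivatives of `weight * φ`, with the first derivative of `φ` eliminated
from the formula for the second. -/
theorem hessian_cylinderWeight_mul {c : ℂ} {R : ℝ} {φ : ℝ × ℂ → ℝ} {p : ℝ × ℂ}
    (hφ : ContDiffAt ℝ 2 φ p) {v : ℂ} (hv : ‖v‖ = 1) {σ σ' : ℝ}
    (hσ : σ = 1 - ‖p.2 - c‖ ^ 2 / R ^ 2) (hσ0 : σ ≠ 0)
    (hσ' : σ' = -(2 * inner ℝ (p.2 - c) v / R ^ 2)) :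
    fderiv ℝ (fderiv ℝ fun q => cylinderWeight c R q * φ q) p (0, v) (0, v) =
      12 * (σ' / σ) * fderiv ℝ (fun q => cylinderWeight c R q * φ q) p (0, v)
        + p.1 ^ 3 * σ ^ 6 * fderiv ℝ (fderiv ℝ φ) p (0, v) (0, v)
        - p.1 ^ 3 * (42 * σ ^ 4 * σ' ^ 2 + 12 / R ^ 2 * σ ^ 5) * φ p := by
  have hw : ContDiffAt ℝ 2 (fun q => cylinderWeight c R q * φ q) p :=
    (contDiff_cylinderWeight c R).contDiffAt.mul hφ
  obtain ⟨hw1, hw2⟩ := hw.hasDerivAt_line ((0 : ℝ), v)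
  obtain ⟨hφ1, hφ2⟩ := hφ.hasDerivAt_line ((0 : ℝ), v)
  set ψ : ℝ → ℝ := fun s => φ (p + s • ((0 : ℝ), v)) with hψ
  set ψ' : ℝ → ℝ := fun s => fderiv ℝ φ (p + s • ((0 : ℝ), v)) (0, v) with hψ'
  -- Along the line the base of the weight is a quadratic polynomial.
  set S : ℝ → ℝ := fun s => σ + σ' * s - s ^ 2 / R ^ 2 with hS
  set S' : ℝ → ℝ := fun s => σ' - 2 * s / R ^ 2 with hS'
  have hSd : ∀ s, HasDerivAt S (S' s) s := fun s => by
    have := (((hasDerivAt_id s).const_mul σ').const_add σ).sub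
      (((hasDerivAt_id s).pow 2).div_const (R ^ 2))
    exact this.congr_deriv (by simp [hS'])
  have hS'd : HasDerivAt S' (-(2 / R ^ 2)) 0 := by
    have := (((hasDerivAt_id (0 : ℝ)).const_mul 2).div_const (R ^ 2)).const_sub σ'
    exact this.congr_deriv (by simp)
  have hweq : (fun s : ℝ => cylinderWeight c R (p + s • ((0 : ℝ), v)) * φ (p + s • ((0 : ℝ), v)))
      = fun s => p.1 ^ 3 * S s ^ 6 * ψ s := by
    ext s
    have hn : ‖p.2 + s • v - c‖ ^ 2 = ‖p.2 - c‖ ^ 2 + 2 * s * inner ℝ (p.2 - c) v + s ^ 2 := by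
      have : p.2 + s • v - c = (p.2 - c) + s • v := by ring
      rw [this, norm_add_sq_real, inner_smul_right, norm_smul, hv, mul_one,
        Real.norm_eq_abs, sq_abs]
      ring
    have h1 : (p + s • ((0 : ℝ), v)).1 = p.1 := by simp
    have h2 : (p + s • ((0 : ℝ), v)).2 = p.2 + s • v := by simp
    rw [cylinderWeight, h1, h2, hn]
    congr 3
    rw [hS, hσ, hσ']
    ring
  have hd1 : ∀ᶠ s in 𝓝 (0 : ℝ), fderiv ℝ (fun q => cylinderWeight c R q * φ q)
      (p + s • ((0 : ℝ), v)) (0, v) =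
        p.1 ^ 3 * (6 * S s ^ 5 * S' s * ψ s + S s ^ 6 * ψ' s) := by
    filter_upwards [hw1, hφ1] with s h1 h2
    have h3 : HasDerivAt (fun s => p.1 ^ 3 * S s ^ 6 * ψ s)
        (p.1 ^ 3 * (6 * S s ^ 5 * S' s * ψ s + S s ^ 6 * ψ' s)) s :=
      ((((hSd s).pow 6).const_mul (p.1 ^ 3)).mul h2).congr_deriv (by
        simp only [hψ, hψ', Pi.pow_apply]; push_cast; ring)
    exact (hweq ▸ h1).unique h3
  have hψd : HasDerivAt ψ (ψ' 0) 0 := hφ1.self_of_nhds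
  have hd2 : HasDerivAt (fun s => p.1 ^ 3 * (6 * S s ^ 5 * S' s * ψ s + S s ^ 6 * ψ' s))
      (p.1 ^ 3 * (6 * (5 * σ ^ 4 * σ' * σ' + σ ^ 5 * -(2 / R ^ 2)) * ψ 0
        + 6 * σ ^ 5 * σ' * ψ' 0
        + (6 * σ ^ 5 * σ' * ψ' 0 +
          σ ^ 6 * fderiv ℝ (fderiv ℝ φ) p (0, v) (0, v)))) 0 := by
    have e1 := (((((hSd 0).pow 5).const_mul 6).mul hS'd).mul hψd).add (((hSd 0).pow 6).mul hφ2)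
    refine (e1.const_mul (p.1 ^ 3)).congr_deriv ?_
    have hS0 : S 0 = σ := by simp [hS]
    have hS'0 : S' 0 = σ' := by simp [hS']
    simp only [Pi.pow_apply, Pi.mul_apply, hS0, hS'0]
    push_cast
    ring
  have hsecond := (hw2.congr_of_eventuallyEq (hd1.mono fun s hs => hs.symm)).unique hd2
  have hfirst := hd1.self_of_nhds
  have hS0 : S 0 = σ := by simp [hS]
  have hS'0 : S' 0 = σ' := by simp [hS']
  have hψ0 : ψ 0 = φ p := by simp only [hψ, zero_smul, add_zero]
  rw [hS0, hS'0, hψ0, zero_smul, add_zero] at hfirst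
  rw [hψ0] at hsecond
  rw [hsecond, hfirst]
  field_simp
  ring

/-- Consequence for the pure second derivatives of `f`: on the contact set the terms with a first
derivative are controlled by the value of `W = t³ σ⁶ f`. -/
theorem contact_second_derivative_le {R t σ s f w h F W M : ℝ} (hR : 0 < R) (ht : 0 < t)
    (hσ : 0 < σ) (hσ1 : σ ≤ 1) (hf : 0 ≤ f) (hW : W = t ^ 3 * σ ^ 6 * f) (hM : M / 8 ≤ W)
    (hs : |s| ≤ 2 / R) (hw : |w| ≤ M / (8 * R))
    (hh : h = 12 * (s / σ) * w + t ^ 3 * σ ^ 6 * F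
      - t ^ 3 * (42 * σ ^ 4 * s ^ 2 + 12 / R ^ 2 * σ ^ 5) * f) :
    t ^ 3 * σ ^ 6 * F ≤ h + 204 * (W / (R ^ 2 * σ ^ 2)) := by
  have hW0 : 0 ≤ W := by rw [hW]; positivity
  obtain ⟨B, hB⟩ : ∃ B, B = W / (R ^ 2 * σ ^ 2) := ⟨_, rfl⟩
  rw [← hB]
  have hw' : |w| ≤ W / R := hw.trans (by
    rw [div_le_div_iff₀ (by positivity) hR]; nlinarith)
  have e1 : -(12 * (s / σ) * w) ≤ 24 * B := by
    calc -(12 * (s / σ) * w) ≤ |12 * (s / σ) * w| := neg_le_abs _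
      _ = 12 * (|s| / σ) * |w| := by rw [abs_mul, abs_mul, abs_div, abs_of_pos hσ]; norm_num
      _ ≤ 12 * (2 / R / σ) * (W / R) := by gcongr
      _ = 24 * (W / (R ^ 2 * σ ^ 1)) := by field_simp; ring
      _ ≤ 24 * B := by
        rw [hB]
        gcongr 24 * (W / (R ^ 2 * ?_))
        exact pow_le_pow_of_le_one hσ.le hσ1 (by norm_num)
  have e2 : t ^ 3 * (42 * σ ^ 4 * s ^ 2) * f ≤ 168 * B := by
    have hs2 : s ^ 2 ≤ (2 / R) ^ 2 := by
      rw [← sq_abs]; gcongr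
    calc t ^ 3 * (42 * σ ^ 4 * s ^ 2) * f ≤ t ^ 3 * (42 * σ ^ 4 * (2 / R) ^ 2) * f := by gcongr
      _ = 168 * B := by rw [hB, hW]; field_simp; ring
  have e3 : t ^ 3 * (12 / R ^ 2 * σ ^ 5) * f ≤ 12 * B := by
    calc t ^ 3 * (12 / R ^ 2 * σ ^ 5) * f ≤ t ^ 3 * (12 / R ^ 2 * σ ^ 4) * f := by
          gcongr t ^ 3 * (12 / R ^ 2 * ?_) * f
          exact pow_le_pow_of_le_one hσ.le hσ1 (by norm_num)
      _ = 12 * B := by rw [hB, hW]; field_simp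
  linarith

/-- The bound on `∂ₜw · (Δw)² / 4` that is needed for the ABP estimate, in real variables: `σ` is
the base of the weight, `f` the value of the subsolution, `wt`, `wa`, `wb`, `haa`, `hbb` are
derivatives of `t³ σ⁶ f`, and `ft`, `faa`, `fbb` those of `f`. -/
theorem contact_inequality {R T γ₀ Γ Λ t σ sa sb f ft faa fbb wa wb haa hbb wt γ M : ℝ}
    (hR : 0 < R) (hγ₀ : 0 < γ₀) (hΛ : 0 ≤ Λ) (ht : 0 < t) (htT : t ≤ T)
    (hσ : 0 < σ) (hσ1 : σ ≤ 1) (hsa : |sa| ≤ 2 / R) (hsb : |sb| ≤ 2 / R) (hf : 0 ≤ f)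
    (hM : M / 8 ≤ t ^ 3 * σ ^ 6 * f) (hM' : t ^ 3 * σ ^ 6 * f ≤ M)
    (hwa : |wa| ≤ M / (8 * R)) (hwb : |wb| ≤ M / (8 * R)) (hha : haa ≤ 0) (hhb : hbb ≤ 0)
    (hwt : 0 ≤ wt) (hwteq : wt = 3 * t ^ 2 * σ ^ 6 * f + t ^ 3 * σ ^ 6 * ft)
    (haeq : haa = 12 * (sa / σ) * wa + t ^ 3 * σ ^ 6 * faa
      - t ^ 3 * (42 * σ ^ 4 * sa ^ 2 + 12 / R ^ 2 * σ ^ 5) * f)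
    (hbeq : hbb = 12 * (sb / σ) * wb + t ^ 3 * σ ^ 6 * fbb
      - t ^ 3 * (42 * σ ^ 4 * sb ^ 2 + 12 / R ^ 2 * σ ^ 5) * f)
    (hγ : γ ∈ Icc γ₀ Γ) (hpde : ft ≤ γ * (faa + fbb) + Λ * f) :
    wt * ((haa + hbb) ^ 2 / 4) ≤
      (3 + (408 * Γ / R ^ 2 + Λ) * T) ^ 3 * M ^ 2 / (4 * γ₀ ^ 2) * f := by
  obtain ⟨W, hW⟩ : ∃ W, W = t ^ 3 * σ ^ 6 * f := ⟨_, rfl⟩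
  rw [← hW] at hM hM'
  have hW0 : 0 ≤ W := by rw [hW]; positivity
  have hγ0 : 0 < γ := hγ₀.trans_le hγ.1
  have hT : 0 < T := ht.trans_le htT
  have ha := contact_second_derivative_le hR ht hσ hσ1 hf hW hM hsa hwa haeq
  have hb := contact_second_derivative_le hR ht hσ hσ1 hf hW hM hsb hwb hbeq
  obtain ⟨B, hB⟩ : ∃ B, B = W / (R ^ 2 * σ ^ 2) := ⟨_, rfl⟩
  rw [← hB] at ha hb
  have hB0 : 0 ≤ B := by rw [hB]; positivity
  obtain ⟨A, hA⟩ : ∃ A, A = 3 + (408 * Γ / R ^ 2 + Λ) * T := ⟨_, rfl⟩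
  rw [← hA]
  have hΓ : 0 < Γ := hγ0.trans_le hγ.2
  have hA0 : 0 ≤ A := by rw [hA]; positivity
  obtain ⟨E, hE⟩ : ∃ E, E = A * (W / (t * σ ^ 2)) := ⟨_, rfl⟩
  have hE0 : 0 ≤ E := by rw [hE]; positivity
  have hmain : wt + γ * -(haa + hbb) ≤ E := by
    have e0 : wt ≤ 3 * (W / t) + Λ * W + γ * (haa + hbb + 408 * B) := by
      have h1 : t ^ 3 * σ ^ 6 * ft ≤ t ^ 3 * σ ^ 6 * (γ * (faa + fbb) + Λ * f) := by gcongr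
      have h2 : 3 * t ^ 2 * σ ^ 6 * f = 3 * (W / t) := by rw [hW]; field_simp
      have h3 : γ * (t ^ 3 * σ ^ 6 * faa + t ^ 3 * σ ^ 6 * fbb) ≤ γ * (haa + hbb + 408 * B) := by
        gcongr γ * ?_; linarith
      rw [hwteq, h2]
      have h4 : t ^ 3 * σ ^ 6 * (γ * (faa + fbb) + Λ * f)
        = γ * (t ^ 3 * σ ^ 6 * faa + t ^ 3 * σ ^ 6 * fbb) + Λ * W := by rw [hW]; ring
      linarith
    have hσ2 : σ ^ 2 ≤ 1 := pow_le_one₀ hσ.le hσ1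
    have htσ : t * σ ^ 2 ≤ t := mul_le_of_le_one_right ht.le hσ2
    have hWt : W / t ≤ W / (t * σ ^ 2) := div_le_div_of_nonneg_left hW0 (by positivity) htσ
    have hWT : W ≤ T * (W / (t * σ ^ 2)) := by
      rw [← mul_div_assoc, le_div_iff₀ (by positivity)]
      rw [mul_comm]
      exact mul_le_mul_of_nonneg_right (htσ.trans htT) hW0
    have hBT : B ≤ T / R ^ 2 * (W / (t * σ ^ 2)) := by
      have : T / R ^ 2 * (W / (t * σ ^ 2)) = T / t * B := by rw [hB]; field_simp
      rw [this]
      exact le_mul_of_one_le_left hB0 ((one_le_div ht).2 htT)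
    have h5 : γ * (408 * B) ≤ Γ * (408 * (T / R ^ 2 * (W / (t * σ ^ 2)))) := by
      gcongr; exact hγ.2
    have h6 : Λ * W ≤ Λ * (T * (W / (t * σ ^ 2))) := by gcongr
    have h7 : E = 3 * (W / (t * σ ^ 2)) + Λ * (T * (W / (t * σ ^ 2)))
        + Γ * (408 * (T / R ^ 2 * (W / (t * σ ^ 2)))) := by rw [hE, hA]; ring
    linarith
  have hS0 : 0 ≤ -(haa + hbb) := by linarith
  have hwE : wt ≤ E := by linarith [mul_nonneg hγ0.le hS0]
  have hSE : -(haa + hbb) ≤ E / γ₀ := by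
    rw [le_div_iff₀ hγ₀]
    linarith [mul_le_mul_of_nonneg_right hγ.1 hS0]
  calc wt * ((haa + hbb) ^ 2 / 4) = wt * ((-(haa + hbb)) ^ 2 / 4) := by ring
    _ ≤ E * ((E / γ₀) ^ 2 / 4) := by gcongr
    _ = A ^ 3 * W ^ 2 / (4 * γ₀ ^ 2) * f := by
      rw [hE]
      have h3 : W ^ 3 = W ^ 2 * (t ^ 3 * σ ^ 6 * f) := by rw [← hW]; ring
      field_simp
      rw [h3]
      ring
    _ ≤ A ^ 3 * M ^ 2 / (4 * γ₀ ^ 2) * f := by gcongr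

/-- **Local maximum principle**: a function that satisfies `∂ₜφ ≤ γ Δφ + Λ φ` where it is at least
`1`, with a coefficient `γ` that is only known to lie between two positive constants, is bounded
at positive times in the interior of a cylinder by its `L¹` norm. -/
theorem exists_local_bound {R T₀ T γ₀ Γ Λ : ℝ} (hR : 0 < R) (hT₀ : 0 < T₀) (hT : T₀ < T)
    (hγ₀ : 0 < γ₀) (hΓ : γ₀ ≤ Γ) (hΛ : 0 ≤ Λ) :
    ∃ C : ℝ, 0 < C ∧ ∀ (c : ℂ) (φ : ℝ × ℂ → ℝ), ∀ t₁ ∈ Ico T₀ T,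
      ContinuousOn φ (Icc 0 t₁ ×ˢ Metric.closedBall c R) →
      (∀ p ∈ Ioc 0 t₁ ×ˢ Metric.ball c R, ContDiffAt ℝ 2 φ p) →
      (∀ p ∈ Ioc 0 t₁ ×ˢ Metric.ball c R, 1 ≤ φ p → ∃ γ ∈ Icc γ₀ Γ,
        fderiv ℝ φ p (1, 0) ≤ γ * (fderiv ℝ (fderiv ℝ φ) p (0, 1) (0, 1)
          + fderiv ℝ (fderiv ℝ φ) p (0, Complex.I) (0, Complex.I)) + Λ * φ p) →
      ∀ J : ℝ, 0 ≤ J →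
        ∫⁻ p in Ioc 0 t₁ ×ˢ Metric.ball c R, ENNReal.ofReal (φ p) ≤ ENNReal.ofReal J →
      ∀ z ∈ Metric.ball c (R / 2), φ (t₁, z) ≤ C * max 1 J := by
  have hT0 : 0 < T := hT₀.trans hT
  have hΓ0 : 0 < Γ := hγ₀.trans_le hΓ
  set A := 3 + (408 * Γ / R ^ 2 + Λ) * T with hA
  have hA0 : 0 < A := by positivity
  set B := 64 * R ^ 2 * A ^ 3 / (Real.pi * γ₀ ^ 2) with hB
  have hB0 : 0 < B := by have := Real.pi_pos; positivity
  set m := T₀ ^ 3 * (3 / 4) ^ 6 with hm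
  have hm0 : 0 < m := by positivity
  refine ⟨(8 * T ^ 3 + B) / m, by positivity, ?_⟩
  intro c φ t₁ ht₁ hcont hdiff hpde J hJ hint z hz
  have ht₁0 : 0 < t₁ := hT₀.trans_le ht₁.1
  have hmax1 : 1 ≤ max 1 J := le_max_left _ _
  set w : ℝ × ℂ → ℝ := fun q => cylinderWeight c R q * φ q with hw
  have hwc : ContinuousOn w (Icc 0 t₁ ×ˢ Metric.closedBall c R) :=
    (contDiff_cylinderWeight c R).continuous.continuousOn.mul hcont
  have hKc : IsCompact (Icc (0 : ℝ) t₁ ×ˢ Metric.closedBall c R) :=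
    isCompact_Icc.prod (isCompact_closedBall c R)
  have hzK : (t₁, z) ∈ Icc (0 : ℝ) t₁ ×ˢ Metric.closedBall c R :=
    ⟨⟨ht₁0.le, le_rfl⟩, Metric.ball_subset_closedBall (Metric.ball_subset_ball (by linarith) hz)⟩
  obtain ⟨p₀, hp₀, hmaxp⟩ := hKc.exists_isMaxOn ⟨_, hzK⟩ hwc
  set M := w p₀ with hM
  have hwM : ∀ p ∈ Icc (0 : ℝ) t₁ ×ˢ Metric.closedBall c R, w p ≤ M := fun p hp => hmaxp hp
  -- It suffices to bound the maximum of the weighted function.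
  suffices hbound : M ≤ 8 * T ^ 3 + B * J by
    have hw1 := (hwM _ hzK).trans hbound
    have h2 : 8 * T ^ 3 + B * J ≤ (8 * T ^ 3 + B) * max 1 J := by
      have : J ≤ max 1 J := le_max_right _ _
      have h3 : B * J ≤ B * max 1 J := by gcongr
      have h4 : 8 * T ^ 3 * 1 ≤ 8 * T ^ 3 * max 1 J := by gcongr
      linarith
    rcases le_or_gt (φ (t₁, z)) 0 with hneg | hpos
    · exact hneg.trans (by positivity)
    have hmw : m ≤ cylinderWeight c R (t₁, z) := by
      have hz' : ‖z - c‖ ≤ R / 2 := by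
        simpa [dist_eq_norm] using (Metric.mem_ball.1 hz).le
      have h5 : ‖z - c‖ ^ 2 / R ^ 2 ≤ 1 / 4 := by
        calc ‖z - c‖ ^ 2 / R ^ 2 ≤ (R / 2) ^ 2 / R ^ 2 := by gcongr
          _ = 1 / 4 := by field_simp; norm_num
      rw [hm, cylinderWeight]
      gcongr
      · exact ht₁.1
      · linarith
    rw [div_mul_eq_mul_div, le_div_iff₀ hm0, mul_comm]
    calc m * φ (t₁, z) ≤ cylinderWeight c R (t₁, z) * φ (t₁, z) := by gcongr
      _ ≤ _ := hw1.trans h2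
  rcases lt_or_ge M (8 * T ^ 3) with hlt | hge
  · have : 0 ≤ B * J := by positivity
    linarith
  have hM0 : 0 < M := lt_of_lt_of_le (by positivity) hge
  have habp := parabolic_abp (w := w) (G := fun p => A ^ 3 * M ^ 2 / (4 * γ₀ ^ 2) * φ p) (c := c)
    (t₁ := t₁) hR hM0 hwc
    (fun p hp => (contDiff_cylinderWeight c R).contDiffAt.mul (hdiff p hp))
    (fun y _ => by simp [hw, cylinderWeight])
    (fun t _ y hy => by
      have : ‖y - c‖ = R := by simpa [dist_eq_norm] using hy
      simp [hw, cylinderWeight, this, hR.ne'])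
    ⟨p₀, hp₀, le_rfl⟩
    (fun p hp => ((hdiff p hp).continuousAt.continuousWithinAt).const_mul _)
    (by
      intro p hp hlow hwt hgrad hhess
      obtain ⟨ht, hy⟩ := hp
      have hy' : ‖p.2 - c‖ < R := by simpa [dist_eq_norm] using hy
      have hpT : p.1 ≤ T := ht.2.trans ht₁.2.le
      set σ := 1 - ‖p.2 - c‖ ^ 2 / R ^ 2 with hσ
      have hσ0 : 0 < σ := by
        rw [hσ, sub_pos, div_lt_one (by positivity)]
        gcongr
      have hσ1 : σ ≤ 1 := by
        rw [hσ]; linarith [show 0 ≤ ‖p.2 - c‖ ^ 2 / R ^ 2 by positivity]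
      have hwp : w p = p.1 ^ 3 * σ ^ 6 * φ p := rfl
      have ht0 : 0 < p.1 := ht.1
      -- Since the weight is at most `T³` and `M ≥ 8 T³`, contact happens where `φ ≥ 1`.
      have hφ1 : 1 ≤ φ p := by
        by_contra! hlt
        have h1 : p.1 ^ 3 * σ ^ 6 ≤ T ^ 3 * 1 := by
          gcongr
          exact pow_le_one₀ hσ0.le hσ1
        have h2 : p.1 ^ 3 * σ ^ 6 * φ p < p.1 ^ 3 * σ ^ 6 * 1 :=
          mul_lt_mul_of_pos_left hlt (by positivity)
        linarith
      have hs : ∀ v : ℂ, ‖v‖ = 1 → |-(2 * inner ℝ (p.2 - c) v / R ^ 2)| ≤ 2 / R := fun v hv => by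
        have h1 : |inner ℝ (p.2 - c) v| ≤ R := by
          have := abs_real_inner_le_norm (p.2 - c) v
          rw [hv, mul_one] at this
          linarith
        rw [abs_neg, abs_div, abs_mul, abs_of_pos (show (0 : ℝ) < R ^ 2 by positivity),
          abs_of_pos (show (0 : ℝ) < 2 by norm_num), div_le_div_iff₀ (by positivity) hR]
        nlinarith
      obtain ⟨γ, hγ, hle⟩ := hpde p ⟨ht, hy⟩ hφ1
      have hd := hdiff p ⟨ht, hy⟩
      have h1 : ‖(1 : ℂ)‖ = 1 := by simp
      have hI : ‖Complex.I‖ = 1 := by simp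
      exact contact_inequality hR hγ₀ hΛ ht0 hpT hσ0 hσ1 (hs 1 h1) (hs Complex.I hI)
        (by linarith) (hwp ▸ hlow)
        (hwp ▸ hwM p ⟨Ioc_subset_Icc_self ht, Metric.ball_subset_closedBall hy⟩)
        (hgrad 1 h1) (hgrad Complex.I hI) (hhess 1) (hhess Complex.I) hwt
        (fderiv_cylinderWeight_mul_time hd)
        (hessian_cylinderWeight_mul hd h1 rfl hσ0.ne' rfl)
        (hessian_cylinderWeight_mul hd hI rfl hσ0.ne' rfl) hγ hle)
  have hcM : 0 ≤ A ^ 3 * M ^ 2 / (4 * γ₀ ^ 2) := by positivity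
  simp only [ENNReal.ofReal_mul hcM] at habp
  rw [lintegral_const_mul' _ _ ENNReal.ofReal_ne_top] at habp
  have h2 : ENNReal.ofReal (M / 4 * (Real.pi * (M / (8 * R)) ^ 2)) ≤
      ENNReal.ofReal (A ^ 3 * M ^ 2 / (4 * γ₀ ^ 2) * J) := by
    rw [ENNReal.ofReal_mul hcM]
    exact habp.trans (by gcongr)
  rw [ENNReal.ofReal_le_ofReal_iff (by positivity)] at h2
  have hpi := Real.pi_pos
  have h3 : M ≤ B * J := by
    have e1 : M / 4 * (Real.pi * (M / (8 * R)) ^ 2) = M ^ 2 * (Real.pi / (256 * R ^ 2)) * M := by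
      field_simp; norm_num
    have e2 : A ^ 3 * M ^ 2 / (4 * γ₀ ^ 2) * J = M ^ 2 * (Real.pi / (256 * R ^ 2)) * (B * J) := by
      rw [hB]; field_simp; ring
    rw [e1, e2] at h2
    exact le_of_mul_le_mul_left h2 (by positivity)
  have : 0 ≤ 8 * T ^ 3 := by positivity
  linarith

/-! ### The flow in a holomorphic coordinate -/

theorem laplacian_slice {φ : ℝ × ℂ → ℝ} {t : ℝ} {z : ℂ} (hφ : ContDiffAt ℝ 2 φ (t, z)) :
    (Δ fun y => φ (t, y)) z = fderiv ℝ (fderiv ℝ φ) (t, z) (0, 1) (0, 1)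
      + fderiv ℝ (fderiv ℝ φ) (t, z) (0, Complex.I) (0, Complex.I) := by
  have hslice : ContDiffAt ℝ 2 (fun y => φ (t, y)) z :=
    hφ.comp z (contDiffAt_const.prodMk contDiffAt_id)
  have key : ∀ v : ℂ, fderiv ℝ (fderiv ℝ fun y => φ (t, y)) z v v
      = fderiv ℝ (fderiv ℝ φ) (t, z) (0, v) (0, v) := fun v => by
    obtain ⟨h1, h2⟩ := hslice.hasDerivAt_line v
    obtain ⟨h3, h4⟩ := hφ.hasDerivAt_line ((0 : ℝ), v)
    have heq : ∀ s : ℝ, (t, z) + s • ((0 : ℝ), v) = (t, z + s • v) := fun s => by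
      rw [Prod.smul_mk, Prod.mk_add_mk, smul_zero, add_zero]
    simp only [heq] at h3 h4
    have h5 : ∀ᶠ s in 𝓝 (0 : ℝ), fderiv ℝ φ (t, z + s • v) (0, v)
        = fderiv ℝ (fun y => φ (t, y)) (z + s • v) v := by
      filter_upwards [h1, h3] with s hs1 hs3 using hs3.unique hs1
    exact h2.unique (h4.congr_of_eventuallyEq (h5.mono fun s hs => hs.symm))
  rw [InnerProductSpace.laplacian_eq_iteratedFDeriv_complexPlane]
  simp only [iteratedFDeriv_two_apply]
  simp [key]

theorem isManifold_real_of_complex (S : Type*) [TopologicalSpace S] [ChartedSpace ℂ S]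
    [IsManifold 𝓘(ℂ) ω S] : IsManifold 𝓘(ℝ, ℂ) ∞ S := by
  refine isManifold_of_contDiffOn 𝓘(ℝ, ℂ) ∞ S fun e e' he he' => ?_
  have h := HasGroupoid.compatible (G := contDiffGroupoid ω 𝓘(ℂ)) he he'
  have h2 := contMDiffOn_iff_contDiffOn.1 (contMDiffOn_of_mem_contDiffGroupoid h)
  have h3 : ContDiffOn ℝ ∞ (e.symm ≫ₕ e') (e.symm ≫ₕ e').source :=
    (h2.restrict_scalars ℝ).of_le (by simp)
  simpa using h3

/-- The function `e^f + (α/2) κ e^{-f}` to which the right-hand side of the flow applies a linear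
operator. -/
def potential {S : Type*} (κ : S → ℝ) (α : ℝ) (f : ℝ → S → ℝ) (t : ℝ) (x : S) : ℝ :=
  Real.exp (f t x) + α / 2 * κ x * Real.exp (-f t x)

theorem exp_le_of_potential_le {S : Type*} {κ : S → ℝ} {α K X : ℝ} {f : ℝ → S → ℝ} {t : ℝ} {x : S}
    (hα : 0 < α) (hK0 : 0 ≤ K) (hK : -K ≤ κ x) (hX : 0 ≤ X) (h : potential κ α f t x ≤ X) :
    Real.exp (f t x) ≤ 1 + α / 2 * K + X := by
  rcases le_or_gt (f t x) 0 with hf | hf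
  · have := Real.exp_le_one_iff.2 hf
    have : 0 ≤ α / 2 * K := by positivity
    linarith
  · have h1 : Real.exp (-f t x) ≤ 1 := Real.exp_le_one_iff.2 (by linarith)
    have h2 : -(α / 2 * K) ≤ α / 2 * κ x * Real.exp (-f t x) := by
      have h3 : 0 ≤ α / 2 * Real.exp (-f t x) := by positivity
      have h4 : α / 2 * K * Real.exp (-f t x) ≤ α / 2 * K * 1 := by gcongr
      nlinarith
    rw [potential] at h
    linarith

theorem potential_le_exp {S : Type*} {κ : S → ℝ} {α : ℝ} {f : ℝ → S → ℝ} {t : ℝ} {x : S}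
    (hα : 0 < α) (hκ : κ x ≤ 0) : potential κ α f t x ≤ Real.exp (f t x) := by
  have : 0 ≤ α / 2 * -κ x * Real.exp (-f t x) := by
    have := neg_nonneg.2 hκ
    positivity
  rw [potential]
  linarith

theorem continuousOn_chart_prod {S : Type*} [TopologicalSpace S]
    {e : OpenPartialHomeomorph S ℂ} {F : ℝ × S → ℝ}
    {I : Set ℝ} {D : Set ℂ} (hF : ContinuousOn F (I ×ˢ univ)) (hD : D ⊆ e.target) :
    ContinuousOn (fun p : ℝ × ℂ => F (p.1, e.symm p.2)) (I ×ˢ D) :=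
  hF.comp (continuousOn_fst.prodMk ((e.continuousOn_symm.mono hD).comp continuousOn_snd
    fun _ hp => hp.2)) fun _ hp => ⟨hp.1, mem_univ _⟩

section Flow

variable {S : Type*} [TopologicalSpace S] [ChartedSpace ℂ S]
  {g : HermitianMetric S} {κ : S → ℝ} {α T : ℝ} {f : ℝ → S → ℝ}

theorem IsFlowSolution.continuousOn (hf : IsFlowSolution g κ α T f) :
    ContinuousOn (fun p : ℝ × S => f p.1 p.2) (Ico 0 T ×ˢ univ) :=
  hf.smooth.continuousOn

theorem IsFlowSolution.continuous_exp (hf : IsFlowSolution g κ α T f) {t : ℝ} (ht : t ∈ Ico 0 T) :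
    Continuous fun x => Real.exp (f t x) := by
  rw [← continuousOn_univ]
  exact (hf.continuousOn.comp (Continuous.prodMk_right t).continuousOn
    fun x _ => ⟨ht, mem_univ _⟩).rexp

theorem IsFlowSolution.continuousOn_potential (hf : IsFlowSolution g κ α T f)
    (hκ : Continuous κ) :
    ContinuousOn (fun p : ℝ × S => potential κ α f p.1 p.2) (Ico 0 T ×ˢ univ) := by
  have h1 : ContinuousOn (fun p : ℝ × S => κ p.2) (Ico 0 T ×ˢ univ) :=
    (hκ.comp continuous_snd).continuousOn
  exact hf.continuousOn.rexp.add ((continuousOn_const.mul h1).mul hf.continuousOn.neg.rexp)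

variable [IsManifold 𝓘(ℂ) ω S]

theorem IsFlowSolution.contDiffAt_chart (hf : IsFlowSolution g κ α T f)
    {e : OpenPartialHomeomorph S ℂ} (he : e ∈ atlas ℂ S) {p : ℝ × ℂ} (ht : p.1 ∈ Ioo 0 T)
    (hz : p.2 ∈ e.target) : ContDiffAt ℝ ∞ (fun q : ℝ × ℂ => f q.1 (e.symm q.2)) p := by
  have := isManifold_real_of_complex S
  have hsymm : ContMDiffOn 𝓘(ℝ, ℂ) 𝓘(ℝ, ℂ) ∞ e.symm e.target :=
    contMDiffOn_symm_of_mem_maximalAtlas (IsManifold.subset_maximalAtlas he)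
  have hmap : ContMDiffOn (𝓘(ℝ, ℝ).prod 𝓘(ℝ, ℂ)) (𝓘(ℝ, ℝ).prod 𝓘(ℝ, ℂ)) ∞
      (fun q : ℝ × ℂ => (q.1, e.symm q.2)) (Ioo 0 T ×ˢ e.target) :=
    contMDiffOn_fst.prodMk (hsymm.comp contMDiffOn_snd fun q hq => hq.2)
  have hcomp := hf.smooth.comp hmap fun q hq => ⟨Ioo_subset_Ico_self hq.1, mem_univ _⟩
  rw [← modelWithCornersSelf_prod, chartedSpaceSelf_prod, contMDiffOn_iff_contDiffOn] at hcomp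
  exact hcomp.contDiffAt ((isOpen_Ioo.prod e.open_target).mem_nhds ⟨ht, hz⟩)

theorem IsFlowSolution.contDiffAt_potential (hf : IsFlowSolution g κ α T f)
    (hκ : ContMDiff 𝓘(ℝ, ℂ) 𝓘(ℝ, ℝ) ∞ κ)
    {e : OpenPartialHomeomorph S ℂ} (he : e ∈ atlas ℂ S) {p : ℝ × ℂ} (ht : p.1 ∈ Ioo 0 T)
    (hz : p.2 ∈ e.target) :
    ContDiffAt ℝ 2 (fun q : ℝ × ℂ => potential κ α f q.1 (e.symm q.2)) p := by
  have := isManifold_real_of_complex S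
  have hsymm : ContMDiffOn 𝓘(ℝ, ℂ) 𝓘(ℝ, ℂ) ∞ e.symm e.target :=
    contMDiffOn_symm_of_mem_maximalAtlas (IsManifold.subset_maximalAtlas he)
  have hκe : ContDiffAt ℝ ∞ (fun z => κ (e.symm z)) p.2 :=
    (contMDiffOn_iff_contDiffOn.1 (hκ.comp_contMDiffOn hsymm)).contDiffAt
      (e.open_target.mem_nhds hz)
  have hκp : ContDiffAt ℝ ∞ (fun q : ℝ × ℂ => κ (e.symm q.2)) p := hκe.comp p contDiffAt_snd
  have hfp := hf.contDiffAt_chart he ht hz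
  have h : ContDiffAt ℝ ∞ (fun q : ℝ × ℂ => potential κ α f q.1 (e.symm q.2)) p :=
    hfp.exp.add ((contDiffAt_const.mul hκp).mul hfp.neg.exp)
  exact h.of_le (WithTop.coe_le_coe.2 (le_top : (2 : ℕ∞) ≤ ⊤))

/-- The potential satisfies a parabolic equation in nondivergence form without first order terms:
`∂ₜφ = (1 - (α/2) κ e^{-2f}) ∂ₜe^f`. Where it is at least `1`, so is `e^f`, and hence the factor
lies between two positive constants. -/
theorem IsFlowSolution.potential_subsolution (hf : IsFlowSolution g κ α T f)
    (hκ : ContMDiff 𝓘(ℝ, ℂ) 𝓘(ℝ, ℝ) ∞ κ) (hκ_nonpos : ∀ x, κ x ≤ 0) (hα : 0 < α) {K : ℝ}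
    (hK : ∀ x, -K ≤ κ x)
    {e : OpenPartialHomeomorph S ℂ} (he : e ∈ atlas ℂ S) {φ : ℝ × ℂ → ℝ}
    (hφ : φ = fun q => potential κ α f q.1 (e.symm q.2)) {p : ℝ × ℂ} (ht : p.1 ∈ Ioo 0 T)
    (hz : p.2 ∈ e.target) (h1 : 1 ≤ φ p) :
    ∃ b ∈ Icc 1 (1 + α / 2 * K), fderiv ℝ φ p (1, 0) ≤
      b / (4 * g.coeff e p.2) * (fderiv ℝ (fderiv ℝ φ) p (0, 1) (0, 1)
          + fderiv ℝ (fderiv ℝ φ) p (0, Complex.I) (0, Complex.I))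
        + (1 + α / 2 * K) * K * φ p := by
  obtain ⟨t, z⟩ := p
  set x := e.symm z with hx
  have hd : ContDiffAt ℝ 2 φ (t, z) := hφ ▸ hf.contDiffAt_potential hκ he ht hz
  have hxs : x ∈ e.source := e.map_target hz
  set D := g.ddbar e (fun y => Real.exp (f t y) + α / 2 * κ y * Real.exp (-f t y)) x
        - κ x * (Real.exp (f t x) + α / 2 * κ x * Real.exp (-f t x)) with hD
  have heq : HasDerivAt (fun s => Real.exp (f s x)) D t :=
    (hf.equation t (Ioo_subset_Ico_self ht) e he x hxs).hasDerivAt (Ico_mem_nhds ht.1 ht.2)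
  have hφx : φ (t, z) = Real.exp (f t x) + α / 2 * κ x * Real.exp (-f t x) := by rw [hφ]; rfl
  set Lap := fderiv ℝ (fderiv ℝ φ) (t, z) (0, 1) (0, 1)
          + fderiv ℝ (fderiv ℝ φ) (t, z) (0, Complex.I) (0, Complex.I) with hLap
  have hDval : D = (g.coeff e z)⁻¹ * (1 / 4 * Lap) - κ x * φ (t, z) := by
    rw [hD, HermitianMetric.ddbar, e.right_inv hz, hLap, ← laplacian_slice hd, hφx, hφ]
    rfl
  set u := Real.exp (f t x) with hu
  have hu0 : 0 < u := Real.exp_pos _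
  have hu1 : 1 ≤ u := by
    have := potential_le_exp (f := f) (t := t) hα (hκ_nonpos x)
    rw [potential, ← hu] at this
    rw [hφx] at h1
    linarith
  set b := 1 - α / 2 * κ x / u ^ 2 with hb
  have hderiv : fderiv ℝ φ (t, z) (1, 0) = b * D := by
    have h2 := (hd.hasDerivAt_line ((1 : ℝ), (0 : ℂ))).1.self_of_nhds
    have h3 : HasDerivAt (fun s => Real.exp (f s x) + α / 2 * κ x * (Real.exp (f s x))⁻¹)
        (D + α / 2 * κ x * (-D / u ^ 2)) t :=
      heq.add ((heq.inv (Real.exp_ne_zero _)).const_mul _)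
    have h3' : HasDerivAt (fun s => Real.exp (f s x) + α / 2 * κ x * (Real.exp (f s x))⁻¹)
        (D + α / 2 * κ x * (-D / u ^ 2)) (t + 0) := by rwa [add_zero]
    have h4 := h3'.comp_const_add t 0
    have h5 : (fun s : ℝ => φ ((t, z) + s • ((1 : ℝ), (0 : ℂ)))) =
        fun s => Real.exp (f (t + s) x) + α / 2 * κ x * (Real.exp (f (t + s) x))⁻¹ := by
      ext s
      have : (t, z) + s • ((1 : ℝ), (0 : ℂ)) = (t + s, z) := by simp
      rw [this, hφ, ← Real.exp_neg]
      rfl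
    rw [h5, zero_smul, add_zero] at h2
    rw [h2.unique h4, hb]
    field_simp
    ring
  have hκx := hκ_nonpos x
  have hb1 : 1 ≤ b := by
    have : 0 ≤ α / 2 * -κ x / u ^ 2 := by
      have := neg_nonneg.2 hκx
      positivity
    have h2 : α / 2 * -κ x / u ^ 2 = -(α / 2 * κ x / u ^ 2) := by ring
    rw [hb]
    linarith
  have hb2 : b ≤ 1 + α / 2 * K := by
    have h2 : α / 2 * -κ x / u ^ 2 ≤ α / 2 * -κ x := by
      refine div_le_self ?_ (one_le_pow₀ hu1)
      have := neg_nonneg.2 hκx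
      positivity
    have h3 : α / 2 * -κ x ≤ α / 2 * K := by
      gcongr
      linarith [hK x]
    have h4 : α / 2 * -κ x / u ^ 2 = -(α / 2 * κ x / u ^ 2) := by ring
    rw [hb]
    linarith
  refine ⟨b, ⟨hb1, hb2⟩, ?_⟩
  rw [hderiv, hDval]
  have h6 : b * (-κ x) * φ (t, z) ≤ (1 + α / 2 * K) * K * φ (t, z) := by
    have hk0 : 0 ≤ -κ x := neg_nonneg.2 hκx
    have hkK : -κ x ≤ K := by linarith [hK x]
    have : 0 ≤ K := hk0.trans hkK
    gcongr
  have h7 : b * ((g.coeff e z)⁻¹ * (1 / 4 * Lap) - κ x * φ (t, z))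
      = b / (4 * g.coeff e z) * Lap + b * (-κ x) * φ (t, z) := by
    have := (g.pos e he z hz).ne'
    field_simp
    ring
  rw [h7]
  change _ ≤ b / (4 * g.coeff e z) * Lap + _
  linarith

/-- By the maximum principle, `e^f` is bounded on `[0, T)` for each solution. -/
theorem IsFlowSolution.exists_bound [CompactSpace S] (hf : IsFlowSolution g κ α T f)
    (hκ : ContMDiff 𝓘(ℝ, ℂ) 𝓘(ℝ, ℝ) ∞ κ) (hκ_nonpos : ∀ x, κ x ≤ 0) (hα : 0 < α) (hT : 0 < T) :
    ∃ B : ℝ, ∀ t ∈ Ico 0 T, ∀ x, Real.exp (f t x) ≤ B := by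
  obtain ⟨K, hK⟩ : ∃ K : ℝ, ∀ x, -K ≤ κ x := by
    obtain ⟨K, hK⟩ := (isCompact_range hκ.continuous).bddBelow
    exact ⟨-K, fun x => by simpa using hK (mem_range_self x)⟩
  have hcont := hf.continuousOn_potential (α := α) hκ.continuous
  obtain ⟨B₁, hB₁⟩ : ∃ B₁ : ℝ, ∀ x, potential κ α f 0 x ≤ B₁ := by
    have h0 : Continuous fun x => potential κ α f 0 x := by
      rw [← continuousOn_univ]
      exact hcont.comp (Continuous.prodMk_right (0 : ℝ)).continuousOn
        fun x _ => ⟨⟨le_rfl, hT⟩, mem_univ _⟩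
    obtain ⟨B, hB⟩ := (isCompact_range h0).bddAbove
    exact ⟨B, fun x => hB (mem_range_self x)⟩
  set K' := max K 0
  have hK' : ∀ x, -K' ≤ κ x := fun x => (neg_le_neg (le_max_left _ _)).trans (hK x)
  have hK0 : 0 ≤ K' := le_max_right _ _
  set lam := (1 + α / 2 * K') * K' + 1 with hlam
  have hlam0 : 0 < lam := by positivity
  set B₀ := max 1 B₁ with hB₀
  have hB₀1 : 1 ≤ B₀ := le_max_left _ _
  refine ⟨1 + α / 2 * K' + Real.exp (lam * T) * B₀, fun t₁ ht₁ x₁ => ?_⟩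
  refine exp_le_of_potential_le hα hK0 (hK' x₁) (by positivity) ?_
  set Ψ : ℝ × S → ℝ := fun p => Real.exp (-(lam * p.1)) * potential κ α f p.1 p.2 with hΨ
  have hΨc : ContinuousOn Ψ (Icc 0 t₁ ×ˢ univ) := by
    have h1 : Continuous fun p : ℝ × S => Real.exp (-(lam * p.1)) := by fun_prop
    exact h1.continuousOn.mul
      (hcont.mono (prod_mono (fun s hs => ⟨hs.1, hs.2.trans_lt ht₁.2⟩) subset_rfl))
  have hmem : (t₁, x₁) ∈ Icc 0 t₁ ×ˢ (univ : Set S) := ⟨⟨ht₁.1, le_rfl⟩, mem_univ _⟩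
  obtain ⟨⟨t, x⟩, ⟨ht, -⟩, hmax⟩ :=
    (isCompact_Icc.prod isCompact_univ).exists_isMaxOn ⟨_, hmem⟩ hΨc
  have hΨle : ∀ s ∈ Icc 0 t₁, ∀ y, Ψ (s, y) ≤ Ψ (t, x) := fun s hs y => hmax ⟨hs, mem_univ _⟩
  suffices hle : Ψ (t, x) ≤ B₀ by
    have h2 : Real.exp (-(lam * t₁)) * potential κ α f t₁ x₁ ≤ B₀ :=
      (hΨle t₁ ⟨ht₁.1, le_rfl⟩ x₁).trans hle
    calc potential κ α f t₁ x₁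
        = Real.exp (lam * t₁) * (Real.exp (-(lam * t₁)) * potential κ α f t₁ x₁) := by
          rw [← mul_assoc, ← Real.exp_add]; simp
      _ ≤ Real.exp (lam * t₁) * B₀ := by gcongr
      _ ≤ Real.exp (lam * T) * B₀ := by
          gcongr
          exact ht₁.2.le
  by_contra! hgt
  have ht0 : 0 < t := by
    refine lt_of_le_of_ne ht.1 fun h0 => ?_
    rw [hΨ, ← h0] at hgt
    simp only [mul_zero, neg_zero, Real.exp_zero, one_mul] at hgt
    exact absurd ((hB₁ x).trans (le_max_right _ _)) (not_le.2 hgt)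
  have htT : t ∈ Ioo 0 T := ⟨ht0, ht.2.trans_lt ht₁.2⟩
  set e := chartAt ℂ x with he
  have hea : e ∈ atlas ℂ S := chart_mem_atlas ℂ x
  have hxs : x ∈ e.source := mem_chart_source ℂ x
  have hz : e x ∈ e.target := e.map_source hxs
  set φ : ℝ × ℂ → ℝ := fun q => potential κ α f q.1 (e.symm q.2) with hφ
  have hφx : φ (t, e x) = potential κ α f t x := by
    change potential κ α f t (e.symm (e x)) = _
    rw [e.left_inv hxs]
  have hexp : Real.exp (-(lam * t)) ≤ 1 := Real.exp_le_one_iff.2 (by nlinarith)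
  have hφ1 : 1 ≤ φ (t, e x) := by
    rw [hφx]
    by_contra! hlt
    have h3 : Ψ (t, x) ≤ 1 := by
      rcases le_or_gt (potential κ α f t x) 0 with h0 | h0
      · exact (mul_nonpos_of_nonneg_of_nonpos (Real.exp_pos _).le h0).trans zero_le_one
      · exact mul_le_one₀ hexp h0.le hlt.le
    linarith
  have hd : ContDiffAt ℝ 2 φ (t, e x) := hf.contDiffAt_potential hκ hea htT hz
  obtain ⟨b, hb, hle⟩ := hf.potential_subsolution hκ hκ_nonpos hα hK' hea hφ htT hz hφ1
  have hhess : ∀ v : ℂ, fderiv ℝ (fderiv ℝ φ) (t, e x) (0, v) (0, v) ≤ 0 := fun v => by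
    obtain ⟨h1, h2⟩ := hd.hasDerivAt_line ((0 : ℝ), v)
    refine IsLocalMax.second_deriv_nonpos (Eventually.of_forall fun s => ?_) h1 h2
    have h3 := hΨle t ht (e.symm (e x + s • v))
    have h4 := le_of_mul_le_mul_left h3 (Real.exp_pos _)
    have h5 : ∀ r : ℝ, (t, e x) + r • ((0 : ℝ), v) = (t, e x + r • v) := fun r => by
      rw [Prod.smul_mk, Prod.mk_add_mk, smul_zero, add_zero]
    simp only [h5, zero_smul, add_zero, hφx]
    exact h4
  have htime : 0 ≤ fderiv ℝ φ (t, e x) (1, 0) - lam * φ (t, e x) := by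
    have h1 := (hd.hasDerivAt_line ((1 : ℝ), (0 : ℂ))).1.self_of_nhds
    have h2 : HasDerivAt (fun s : ℝ => Real.exp (-(lam * (t + s))))
        (Real.exp (-(lam * t)) * -lam) 0 := by
      have h3 := ((((hasDerivAt_id (0 : ℝ)).const_add t).const_mul lam).neg).exp
      exact h3.congr_deriv (by simp)
    have h4 := h2.mul h1
    have h5 : 0 ≤ Real.exp (-(lam * t)) * (fderiv ℝ φ (t, e x) (1, 0) - lam * φ (t, e x)) := by
      have h6 := h4.nonneg_of_le_left ?_
      · simp only [zero_smul, add_zero] at h6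
        linarith
      · have h7 : ∀ᶠ r in 𝓝[<] (0 : ℝ), -t < r :=
          eventually_nhdsWithin_of_eventually_nhds (lt_mem_nhds (by linarith))
        filter_upwards [h7, self_mem_nhdsWithin] with r hr hr0
        have hr0 : r < 0 := hr0
        have h8 := hΨle (t + r) ⟨by linarith, by linarith [ht.2]⟩ x
        have h9 : ∀ r : ℝ, (t, e x) + r • ((1 : ℝ), (0 : ℂ)) = (t + r, e x) := fun r => by simp
        have h10 : ∀ s : ℝ, φ (s, e x) = potential κ α f s x := fun s => by
          change potential κ α f s (e.symm (e x)) = _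
          rw [e.left_inv hxs]
        simp only [Pi.mul_apply, h9, h10, add_zero]
        exact h8
    exact nonneg_of_mul_nonneg_right h5 (Real.exp_pos _)
  have hg := g.pos e hea _ hz
  have hcoef : 0 ≤ b / (4 * g.coeff e (e x)) := div_nonneg (by linarith [hb.1]) (by positivity)
  have hlap := mul_nonpos_of_nonneg_of_nonpos hcoef
    (add_nonpos (hhess 1) (hhess Complex.I))
  have hlamφ : lam * φ (t, e x) = (1 + α / 2 * K') * K' * φ (t, e x) + φ (t, e x) := by
    rw [hlam]; ring
  linarith

end Flow

/-! ### Comparison with the area measure -/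

section Area

variable {S : Type*} [TopologicalSpace S] [ChartedSpace ℂ S] [MeasurableSpace S] [BorelSpace S]

theorem HermitianMetric.isFiniteMeasure_area [CompactSpace S] [IsManifold 𝓘(ℂ) ω S]
    (g : HermitianMetric S) : IsFiniteMeasure g.area := by
  have hloc : IsLocallyFiniteMeasure g.area := by
    refine ⟨fun x => ?_⟩
    set e := chartAt ℂ x with he
    have hea : e ∈ atlas ℂ S := chart_mem_atlas ℂ x
    have hxs : x ∈ e.source := mem_chart_source ℂ x
    obtain ⟨r, hr, hball⟩ := Metric.nhds_basis_closedBall.mem_iff.1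
      (e.open_target.mem_nhds (e.map_source hxs))
    set N := e.source ∩ e ⁻¹' Metric.ball (e x) r with hN
    have hNo : IsOpen N := e.isOpen_inter_preimage Metric.isOpen_ball
    refine ⟨N, hNo.mem_nhds ⟨hxs, Metric.mem_ball_self hr⟩, ?_⟩
    have hint : IntegrableOn (fun z => 2 * g.coeff e z) (Metric.closedBall (e x) r) :=
      (continuousOn_const.mul ((g.smooth e hea).continuousOn.mono hball)).integrableOn_compact
        (isCompact_closedBall _ _)
    calc g.area N = g.area.restrict e.source N := by
          rw [Measure.restrict_apply hNo.measurableSet, inter_eq_left.2 inter_subset_left]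
      _ = g.chartArea e N := by rw [g.area_restrict_source hea]
      _ = ∫⁻ z in e.target ∩ e.symm ⁻¹' N, ENNReal.ofReal (2 * g.coeff e z) :=
          g.chartArea_apply hNo.measurableSet
      _ ≤ ∫⁻ z in Metric.closedBall (e x) r, ENNReal.ofReal (2 * g.coeff e z) := by
          refine lintegral_mono_set fun z hz => Metric.ball_subset_closedBall ?_
          have := hz.2.2
          rwa [mem_preimage, e.right_inv hz.1] at this
      _ < ⊤ := hint.lintegral_lt_top
  exact ⟨isCompact_univ.measure_lt_top⟩

/-- On a set where the coefficient of the metric is at least `m`, the Lebesgue integral in the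
coordinate is at most `1 / (2m)` times the integral for the area measure. -/
theorem HermitianMetric.setLIntegral_chart_le (g : HermitianMetric S)
    {e : OpenPartialHomeomorph S ℂ} (he : e ∈ atlas ℂ S) {h : S → ℝ} (hh : Continuous h)
    {D : Set ℂ} (hD : D ⊆ e.target) (hDm : MeasurableSet D) {m : ℝ} (hm : 0 < m)
    (hgm : ∀ z ∈ D, m ≤ g.coeff e z) :
    ∫⁻ z in D, ENNReal.ofReal (h (e.symm z)) ≤
      ENNReal.ofReal (1 / (2 * m)) * ∫⁻ y, ENNReal.ofReal (h y) ∂g.area := by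
  have hH : Measurable fun y => ENNReal.ofReal (h y) := hh.measurable.ennreal_ofReal
  have hm1 : AEMeasurable e.symm (volume.restrict e.target) :=
    e.continuousOn_symm.aemeasurable e.open_target.measurableSet
  have hm2 : AEMeasurable (fun z => ENNReal.ofReal (2 * g.coeff e z)) (volume.restrict e.target) :=
    ((continuousOn_const.mul (g.smooth e he).continuousOn).aemeasurable
      e.open_target.measurableSet).ennreal_ofReal
  have hm3 : AEMeasurable (fun z => ENNReal.ofReal (h (e.symm z))) (volume.restrict e.target) :=
    hH.comp_aemeasurable hm1
  calc ∫⁻ z in D, ENNReal.ofReal (h (e.symm z))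
      ≤ ∫⁻ z in D, ENNReal.ofReal (1 / (2 * m)) *
          (ENNReal.ofReal (2 * g.coeff e z) * ENNReal.ofReal (h (e.symm z))) := by
        refine setLIntegral_mono' hDm fun z hz => ?_
        rw [← mul_assoc, ← ENNReal.ofReal_mul (by positivity)]
        refine le_mul_of_one_le_left zero_le (ENNReal.one_le_ofReal.2 ?_)
        rw [div_mul_eq_mul_div, one_mul, one_le_div (by positivity)]
        linarith [hgm z hz]
    _ = ENNReal.ofReal (1 / (2 * m)) *
          ∫⁻ z in D, ENNReal.ofReal (2 * g.coeff e z) * ENNReal.ofReal (h (e.symm z)) :=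
        lintegral_const_mul' _ _ ENNReal.ofReal_ne_top
    _ ≤ ENNReal.ofReal (1 / (2 * m)) * ∫⁻ z in e.target,
          ENNReal.ofReal (2 * g.coeff e z) * ENNReal.ofReal (h (e.symm z)) := by
        gcongr
    _ = ENNReal.ofReal (1 / (2 * m)) * ∫⁻ y, ENNReal.ofReal (h y) ∂g.chartArea e := by
        rw [HermitianMetric.chartArea, lintegral_map' hH.aemeasurable
            (hm1.mono_ac (withDensity_absolutelyContinuous _ _)),
          lintegral_withDensity_eq_lintegral_mul₀ hm2 hm3]
        rfl
    _ ≤ ENNReal.ofReal (1 / (2 * m)) * ∫⁻ y, ENNReal.ofReal (h y) ∂g.area := by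
        gcongr
        exact le_iSup₂ (f := fun e (_ : e ∈ atlas ℂ S) => g.chartArea e) e he

variable {g : HermitianMetric S} {κ : S → ℝ} {α T : ℝ} {f : ℝ → S → ℝ}

variable [CompactSpace S] [IsManifold 𝓘(ℂ) ω S]

theorem IsFlowSolution.integrableOn_exp (hf : IsFlowSolution g κ α T f)
    (hκ : ContMDiff 𝓘(ℝ, ℂ) 𝓘(ℝ, ℝ) ∞ κ) (hκ_nonpos : ∀ x, κ x ≤ 0) (hα : 0 < α) (hT : 0 < T) :
    IntegrableOn (fun p : ℝ × S => Real.exp (f p.1 p.2)) (Ico 0 T ×ˢ univ)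
      (volume.prod g.area) := by
  have hfin := g.isFiniteMeasure_area
  have : SecondCountableTopology S := ChartedSpace.secondCountable_of_sigmaCompact ℂ S
  obtain ⟨B, hB⟩ := hf.exists_bound hκ hκ_nonpos hα hT
  have hms : MeasurableSet (Ico 0 T ×ˢ (univ : Set S)) := measurableSet_Ico.prod MeasurableSet.univ
  refine IntegrableOn.of_bound ?_ (hf.continuousOn.rexp.aestronglyMeasurable hms) B ?_
  · rw [Measure.prod_prod]
    exact ENNReal.mul_lt_top (by simp) (measure_lt_top _ _)
  · filter_upwards [ae_restrict_mem hms] with p hp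
    rw [Real.norm_of_nonneg (Real.exp_pos _).le]
    exact hB p.1 hp.1 p.2

/-- The space-time integral of `e^f` over a coordinate cylinder is controlled by the one over
`[0, T) × S`. -/
theorem IsFlowSolution.setLIntegral_chart_le (hf : IsFlowSolution g κ α T f)
    (hint : IntegrableOn (fun p : ℝ × S => Real.exp (f p.1 p.2)) (Ico 0 T ×ˢ univ)
      (volume.prod g.area))
    {e : OpenPartialHomeomorph S ℂ} (he : e ∈ atlas ℂ S)
    {D : Set ℂ} (hD : D ⊆ e.target) (hDm : MeasurableSet D) {m : ℝ} (hm : 0 < m)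
    (hgm : ∀ z ∈ D, m ≤ g.coeff e z) {t₁ : ℝ} (ht₁ : t₁ ∈ Ico 0 T) :
    ∫⁻ p in Ioc 0 t₁ ×ˢ D, ENNReal.ofReal (Real.exp (f p.1 (e.symm p.2))) ≤
      ENNReal.ofReal (1 / (2 * m) *
        ∫ s in (0 : ℝ)..T, ∫ y, Real.exp (f s y) ∂g.area) := by
  have hfin := g.isFiniteMeasure_area
  set G : ℝ → ℝ := fun s => ∫ y, Real.exp (f s y) ∂g.area with hG
  have hG0 : ∀ s, 0 ≤ G s := fun s => integral_nonneg fun y => (Real.exp_pos _).le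
  have hI : Ioc 0 t₁ ⊆ Ico 0 T := fun s hs => ⟨hs.1.le, hs.2.trans_lt ht₁.2⟩
  have hGint : IntegrableOn G (Ioc 0 T) := by
    have h1 : Integrable (fun p : ℝ × S => Real.exp (f p.1 p.2))
        ((volume.restrict (Ico 0 T)).prod g.area) := by
      rwa [IntegrableOn, ← Measure.prod_restrict, Measure.restrict_univ] at hint
    have h2 : IntegrableOn G (Ico 0 T) := h1.integral_prod_left
    exact h2.congr_set_ae Ico_ae_eq_Ioc.symm
  have hc : ContinuousOn (fun p : ℝ × ℂ => Real.exp (f p.1 (e.symm p.2))) (Ioc 0 t₁ ×ˢ D) :=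
    (continuousOn_chart_prod hf.continuousOn hD).rexp.mono (prod_mono hI subset_rfl)
  calc ∫⁻ p in Ioc 0 t₁ ×ˢ D, ENNReal.ofReal (Real.exp (f p.1 (e.symm p.2)))
      = ∫⁻ s in Ioc 0 t₁, ∫⁻ z in D, ENNReal.ofReal (Real.exp (f s (e.symm z))) := by
        have h1 := (hc.aemeasurable (μ := volume) (measurableSet_Ioc.prod hDm)).ennreal_ofReal
        rw [Measure.volume_eq_prod, ← Measure.prod_restrict] at h1 ⊢
        exact lintegral_prod _ h1
    _ ≤ ∫⁻ s in Ioc 0 t₁, ENNReal.ofReal (1 / (2 * m)) * ENNReal.ofReal (G s) := by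
        refine setLIntegral_mono' measurableSet_Ioc fun s hs => ?_
        have hcs := hf.continuous_exp (hI hs)
        have h1 : Integrable (fun y => Real.exp (f s y)) g.area := by
          obtain ⟨B, hB⟩ := (isCompact_range hcs).bddAbove
          refine Integrable.of_bound hcs.aestronglyMeasurable B (Eventually.of_forall fun y => ?_)
          rw [Real.norm_of_nonneg (Real.exp_pos _).le]
          exact hB (mem_range_self y)
        rw [hG, ofReal_integral_eq_lintegral_ofReal h1
          (Eventually.of_forall fun y => (Real.exp_pos _).le)]
        exact g.setLIntegral_chart_le he hcs hD hDm hm hgm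
    _ = ENNReal.ofReal (1 / (2 * m)) * ∫⁻ s in Ioc 0 t₁, ENNReal.ofReal (G s) :=
        lintegral_const_mul' _ _ ENNReal.ofReal_ne_top
    _ ≤ ENNReal.ofReal (1 / (2 * m)) * ∫⁻ s in Ioc 0 T, ENNReal.ofReal (G s) := by
        gcongr
        exact ht₁.2.le
    _ = ENNReal.ofReal (1 / (2 * m) * ∫ s in (0 : ℝ)..T, G s) := by
        rw [intervalIntegral.integral_of_le (ht₁.1.trans ht₁.2.le),
          ← ofReal_integral_eq_lintegral_ofReal hGint (Eventually.of_forall hG0),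
          ← ENNReal.ofReal_mul (by positivity)]

end Area

/-! ### The estimate on the surface -/

theorem exists_bound_near {S : Type*} [TopologicalSpace S] [CompactSpace S]
    [ChartedSpace ℂ S] [IsManifold 𝓘(ℂ) ω S] [MeasurableSpace S] [BorelSpace S]
    (g : HermitianMetric S) {κ : S → ℝ} (hκ : ContMDiff 𝓘(ℝ, ℂ) 𝓘(ℝ, ℝ) ∞ κ)
    (hκ_nonpos : ∀ x, κ x ≤ 0) {α : ℝ} (hα : 0 < α) {T₀ T : ℝ} (hT₀ : 0 < T₀) (hT : T₀ < T)
    (x : S) :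
    ∃ N ∈ 𝓝 x, ∃ C : ℝ, 0 < C ∧ ∀ f : ℝ → S → ℝ, IsFlowSolution g κ α T f →
      ∀ t ∈ Ico T₀ T, ∀ y ∈ N,
        Real.exp (f t y) ≤ C * max 1 (∫ s in (0 : ℝ)..T, ∫ y, Real.exp (f s y) ∂g.area) := by
  obtain ⟨K, hK0, hK⟩ : ∃ K : ℝ, 0 ≤ K ∧ ∀ x, -K ≤ κ x := by
    obtain ⟨K, hK⟩ := (isCompact_range hκ.continuous).bddBelow
    refine ⟨max (-K) 0, le_max_right _ _, fun x => ?_⟩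
    have h1 : K ≤ κ x := hK (mem_range_self x)
    linarith [le_max_left (-K) 0]
  set e := chartAt ℂ x with he
  have hea : e ∈ atlas ℂ S := chart_mem_atlas ℂ x
  have hxs : x ∈ e.source := mem_chart_source ℂ x
  set c := e x with hc
  obtain ⟨R, hR, hball⟩ := Metric.nhds_basis_closedBall.mem_iff.1
    (e.open_target.mem_nhds (e.map_source hxs))
  have hball' : Metric.ball c R ⊆ e.target := Metric.ball_subset_closedBall.trans hball
  have hgc : ContinuousOn (g.coeff e) (Metric.closedBall c R) :=
    (g.smooth e hea).continuousOn.mono hball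
  have hne : (Metric.closedBall c R).Nonempty := ⟨c, Metric.mem_closedBall_self hR.le⟩
  obtain ⟨z₁, hz₁, hmin⟩ := (isCompact_closedBall c R).exists_isMinOn hne hgc
  obtain ⟨z₂, hz₂, hmax⟩ := (isCompact_closedBall c R).exists_isMaxOn hne hgc
  set m := g.coeff e z₁ with hm
  set m' := g.coeff e z₂ with hm'
  have hm0 : 0 < m := g.pos e hea z₁ (hball hz₁)
  have hmg : ∀ z ∈ Metric.ball c R, m ≤ g.coeff e z ∧ g.coeff e z ≤ m' := fun z hz =>
    ⟨hmin (Metric.ball_subset_closedBall hz), hmax (Metric.ball_subset_closedBall hz)⟩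
  have hmm' : m ≤ m' := hmin hz₂
  have hm'0 : 0 < m' := hm0.trans_le hmm'
  have hαK : 0 ≤ α / 2 * K := by positivity
  have hΓ : 1 / (4 * m') ≤ (1 + α / 2 * K) / (4 * m) := by
    gcongr
    linarith
  obtain ⟨C, hC, hbound⟩ := exists_local_bound (R := R) (Λ := (1 + α / 2 * K) * K) hR hT₀ hT
    (show 0 < 1 / (4 * m') by positivity) hΓ (by positivity)
  refine ⟨e.source ∩ e ⁻¹' Metric.ball c (R / 2),
    (e.isOpen_inter_preimage Metric.isOpen_ball).mem_nhds
      ⟨hxs, Metric.mem_ball_self (by positivity)⟩,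
    1 + α / 2 * K + C * (1 + 1 / (2 * m)), by positivity, ?_⟩
  intro f hf t ht y hy
  have ht0 : t ∈ Ico 0 T := ⟨hT₀.le.trans ht.1, ht.2⟩
  set I := ∫ s in (0 : ℝ)..T, ∫ y, Real.exp (f s y) ∂g.area with hI
  have hI0 : 0 ≤ I := intervalIntegral.integral_nonneg (hT₀.trans hT).le fun s _ =>
    integral_nonneg fun y => (Real.exp_pos _).le
  have hint := hf.integrableOn_exp hκ hκ_nonpos hα (hT₀.trans hT)
  set φ : ℝ × ℂ → ℝ := fun q => potential κ α f q.1 (e.symm q.2) with hφ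
  have hsub : ∀ p ∈ Ioc 0 t ×ˢ Metric.ball c R, p.1 ∈ Ioo 0 T ∧ p.2 ∈ e.target := fun p hp =>
    ⟨⟨hp.1.1, hp.1.2.trans_lt ht.2⟩, hball' hp.2⟩
  have hz : e y ∈ Metric.ball c (R / 2) := hy.2
  have hφle := hbound c φ t ht
    ((continuousOn_chart_prod (hf.continuousOn_potential hκ.continuous) hball).mono
      (prod_mono (fun s hs => ⟨hs.1, hs.2.trans_lt ht.2⟩) subset_rfl))
    (fun p hp => hf.contDiffAt_potential hκ hea (hsub p hp).1 (hsub p hp).2)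
    (fun p hp hp1 => by
      obtain ⟨b, hb, hle⟩ := hf.potential_subsolution hκ hκ_nonpos hα hK hea hφ
        (hsub p hp).1 (hsub p hp).2 hp1
      obtain ⟨h1, h2⟩ := hmg p.2 hp.2
      have hg0 : 0 < g.coeff e p.2 := hm0.trans_le h1
      refine ⟨b / (4 * g.coeff e p.2), ⟨?_, ?_⟩, hle⟩
      · have hb1 := hb.1
        gcongr
      · have hb2 := hb.2
        gcongr)
    (1 / (2 * m) * I) (by positivity)
    ((lintegral_mono fun p => ENNReal.ofReal_le_ofReal (potential_le_exp hα (hκ_nonpos _))).trans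
      (hf.setLIntegral_chart_le hint hea hball' Metric.isOpen_ball.measurableSet hm0
        (fun z hz => (hmg z hz).1) ht0))
    (e y) hz
  have hφy : φ (t, e y) = potential κ α f t y := by
    change potential κ α f t (e.symm (e y)) = _
    rw [e.left_inv hy.1]
  rw [hφy] at hφle
  have hmax1 : 1 ≤ max 1 I := le_max_left _ _
  have hmaxI : max 1 (1 / (2 * m) * I) ≤ (1 + 1 / (2 * m)) * max 1 I := by
    have h0 : 0 ≤ 1 / (2 * m) := by positivity
    refine max_le ?_ ?_
    · nlinarith
    · have : 1 / (2 * m) * I ≤ 1 / (2 * m) * max 1 I := by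
        gcongr
        exact le_max_right _ _
      linarith
  have h1 := exp_le_of_potential_le hα hK0 (hK y) (by positivity) hφle
  have h2 : C * max 1 (1 / (2 * m) * I) ≤ C * ((1 + 1 / (2 * m)) * max 1 I) := by gcongr
  have h3 : (1 + α / 2 * K) * 1 ≤ (1 + α / 2 * K) * max 1 I := by gcongr
  linarith

theorem mainTheorem7 {S : Type*} [TopologicalSpace S] [T2Space S] [CompactSpace S]
    [ChartedSpace ℂ S] [IsManifold 𝓘(ℂ) ω S] [MeasurableSpace S] [BorelSpace S]
    (g : HermitianMetric S) (κ : S → ℝ) (hκ : ContMDiff 𝓘(ℝ, ℂ) 𝓘(ℝ, ℝ) ∞ κ)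
    (hκ_nonpos : ∀ x, κ x ≤ 0) (α : ℝ) (hα : 0 < α) (T₀ T : ℝ) (hT₀ : 0 < T₀) (hT : T₀ < T) :
    ∃ C : ℝ, 0 < C ∧ ∀ f : ℝ → S → ℝ, IsFlowSolution g κ α T f →
      IntegrableOn (fun p : ℝ × S => Real.exp (f p.1 p.2)) (Ico 0 T ×ˢ univ)
        (volume.prod g.area) ∧
      ∀ t ∈ Ico T₀ T, ∀ x : S,
        Real.exp (f t x) ≤ C * max 1 (∫ s in (0 : ℝ)..T, ∫ y, Real.exp (f s y) ∂g.area) := by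
  have key : ∃ C : ℝ, 0 < C ∧ ∀ f : ℝ → S → ℝ, IsFlowSolution g κ α T f →
      ∀ t ∈ Ico T₀ T, ∀ x ∈ (univ : Set S),
        Real.exp (f t x) ≤ C * max 1 (∫ s in (0 : ℝ)..T, ∫ y, Real.exp (f s y) ∂g.area) := by
    refine isCompact_univ.induction_on
      (p := fun A => ∃ C : ℝ, 0 < C ∧ ∀ f : ℝ → S → ℝ, IsFlowSolution g κ α T f →
        ∀ t ∈ Ico T₀ T, ∀ x ∈ A,
          Real.exp (f t x) ≤ C * max 1 (∫ s in (0 : ℝ)..T, ∫ y, Real.exp (f s y) ∂g.area))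
      ⟨1, one_pos, fun _ _ _ _ x hx => absurd hx (notMem_empty x)⟩ ?_ ?_ ?_
    · rintro A B hAB ⟨C, hC, h⟩
      exact ⟨C, hC, fun f hf t ht x hx => h f hf t ht x (hAB hx)⟩
    · rintro A B ⟨C₁, hC₁, h₁⟩ ⟨C₂, hC₂, h₂⟩
      refine ⟨max C₁ C₂, lt_max_of_lt_left hC₁, fun f hf t ht x hx => ?_⟩
      rcases hx with hx | hx
      · refine (h₁ f hf t ht x hx).trans ?_
        gcongr
        exact le_max_left _ _
      · refine (h₂ f hf t ht x hx).trans ?_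
        gcongr
        exact le_max_right _ _
    · intro x _
      obtain ⟨N, hN, h⟩ := exists_bound_near g hκ hκ_nonpos hα hT₀ hT x
      exact ⟨N, mem_nhdsWithin_of_mem_nhds hN, h⟩
  obtain ⟨C, hC, h⟩ := key
  exact ⟨C, hC, fun f hf => ⟨hf.integrableOn_exp hκ hκ_nonpos hα (hT₀.trans hT),
    fun t ht x => h f hf t ht x (mem_univ x)⟩⟩

end
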